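/- Let $R$ be a commutative Noetherian local ring with residue field $k$. For an $R$-module $M$, let $\operatorname{depth}_R M=\inf\{i\ge 0 : \operatorname{Ext}^i_R(k,M)\neq 0\}$; a finitely generated nonzero $R$-module $M$ is Cohen–Macaulay if $\operatorname{depth}_R M=\dim M$, and $R$ is Cohen–Macaulay if it is so as an $R$-module. A quasi-deformation of $R$ is a diagram $R\to R'\leftarrow Q$ of local homomorphisms of Noetherian local rings in which $R'$ is flat over $R$, and $Q\to R'$ is surjective with kernel generated by a $Q$-regular sequence. The complete intersection dimension of an $R$-module $M$ is $$\operatorname{CI-dim}_R M=\inf\{\operatorname{pd}_Q(R'\otimes_R M)-\operatorname{pd}_Q R' : R\to R'\leftarrow Q \text{ is a quasi-deformation}\},$$ where $\operatorname{pd}_Q 0=-\infty$. Assume that $R$ is Cohen–Macaulay of dimension $d$, and let $M$ be a finitely generated Cohen–Macaulay $R$-module of depth $s$. Then $$\operatorname{CI-dim}_R(M)<\infty\iff \operatorname{CI-dim}_R\bigl(\operatorname{Ext}_R^{d-s}(M,R)\bigr)<\infty .$$ -/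

import Mathlib

open CategoryTheory

universe u

/-- The depth of a module `M` over a local ring `(R, 𝔪, k)`: the least `i` with
`Ext^i_R(k, M) ≠ 0`, and `⊤` if there is none. -/
noncomputable def moduleDepth (R : Type u) [CommRing R] [IsLocalRing R]
    (M : Type u) [AddCommGroup M] [Module R M] : ℕ∞ :=
  ⨅ (i : ℕ) (_ : Nontrivial (Abelian.Ext
    (ModuleCat.of R (IsLocalRing.ResidueField R)) (ModuleCat.of R M) i)), (i : ℕ∞)

/-- A (finitely generated, nonzero) module over a Noetherian local ring is Cohen-Macaulay if its
depth equals its Krull dimension. The zero module has depth `⊤` and dimension `⊥`, so it does not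
satisfy the equation. The ring `R` is Cohen-Macaulay if it is so as a module over itself. -/
def IsCohenMacaulayModule (R : Type u) [CommRing R] [IsLocalRing R]
    (M : Type u) [AddCommGroup M] [Module R M] : Prop :=
  (moduleDepth R M : WithBot ℕ∞) = Module.supportDim R M

/-- A quasi-deformation `R ⟶ R' ⟵ Q` of a (Noetherian) local ring `R`: both maps are local
homomorphisms of Noetherian local rings, `R'` is flat over `R`, and `R'` is the quotient of `Q` by
a `Q`-regular sequence. -/
structure QuasiDeformation (R : Type u) [CommRing R] [IsLocalRing R] where
  /-- The ring in the middle of the diagram. -/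
  R' : Type u
  /-- The ring on the right of the diagram. -/
  Q : Type u
  [commRingR' : CommRing R']
  [commRingQ : CommRing Q]
  [isLocalRingR' : IsLocalRing R']
  [isLocalRingQ : IsLocalRing Q]
  [isNoetherianRingR' : IsNoetherianRing R']
  [isNoetherianRingQ : IsNoetherianRing Q]
  [algebraR : Algebra R R']
  [algebraQ : Algebra Q R']
  isLocalHom_left : IsLocalHom (algebraMap R R')
  isLocalHom_right : IsLocalHom (algebraMap Q R')
  flat : Module.Flat R R'
  surjective : Function.Surjective (algebraMap Q R')
  exists_regular : ∃ rs : List Q, RingTheory.Sequence.IsRegular Q rs ∧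
    RingHom.ker (algebraMap Q R') = Ideal.ofList rs

attribute [instance] QuasiDeformation.commRingR' QuasiDeformation.commRingQ
  QuasiDeformation.isLocalRingR' QuasiDeformation.isLocalRingQ
  QuasiDeformation.isNoetherianRingR' QuasiDeformation.isNoetherianRingQ
  QuasiDeformation.algebraR QuasiDeformation.algebraQ

/-- The projective dimension over `Q` of an `R'`-module `X`, regarded as a `Q`-module by
restriction of scalars, as an extended real number (`⊥` for `X = 0`, `⊤` if it is infinite). -/
noncomputable def QuasiDeformation.pd {R : Type u} [CommRing R] [IsLocalRing R]
    (D : QuasiDeformation R) (X : Type u) [AddCommGroup X] [Module D.R' X] : EReal :=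
  WithBot.recBotCoe (⊥ : EReal) (fun n : ℕ∞ => ((n : ENNReal) : EReal))
    (projectiveDimension
      ((ModuleCat.restrictScalars (algebraMap D.Q D.R')).obj (ModuleCat.of D.R' X)))

open scoped TensorProduct in
/-- The complete intersection dimension of an `R`-module `M`: the infimum of
`pd_Q (R' ⊗_R M) - pd_Q R'` over all quasi-deformations `R ⟶ R' ⟵ Q`. As `R'` is flat over `R`,
the derived tensor product is the ordinary one. The number `pd_Q R'` is always finite (it is the
length of the regular sequence), so the subtraction never is `⊤ - ⊤`. -/
noncomputable def ciDim (R : Type u) [CommRing R] [IsLocalRing R]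
    (M : Type u) [AddCommGroup M] [Module R M] : EReal :=
  ⨅ D : QuasiDeformation R, D.pd (D.R' ⊗[R] M) - D.pd D.R'

/-!
Fix a quasi-deformation `R → S ← Q` and let `P` be the class of `R`-modules `X` for which `S ⊗_R X`
has finite projective dimension over `Q` (`FinDeformDim`). The complete intersection dimension of
`X` is finite if and only if `X` lies in `P` for some quasi-deformation, so it suffices to show, for
a fixed one, that `M` lies in `P` if and only if `Ext^{d-s}(M, R)` does. The class `P` has the
two-out-of-three property on short exact sequences and contains the finite free modules.

**Duality.** Suppose `X` is finite, lies in `P`, and satisfies `Ext^i(X, R) = 0` for all `i > 0`.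
Then `X^*` lies in `P` and `Ext^i(X^*, R) = 0` for all `i > 0` (`FinDeformDim.dual`). By faithful
flatness this is a statement about `S`-modules, and it is proved by induction on the length of the
regular sequence (`HasFinProjDimDuality.of_isWeaklyRegular`): for `A₁ = A / x` with `x` regular, an
`A₁`-module `Y` with `Ext^{>0}_{A₁}(Y, A₁) = 0` has a first syzygy `K` over `A` with
`Ext^{>0}_A(K, A) = 0`, and `Hom_{A₁}(Y, A₁) = Ext^1_A(Y, A)` is the quotient of `K^*` by the dual of a free
module; for the empty sequence the modules in question are projective. Together with the vanishing
of `Ext^i(X, R)` for large `i`, it follows that finite modules in `P` have finite Gorenstein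
dimension (`FinDeformDim.finiteGDim`).

**Gorenstein dimension.** Over a local ring, the Gorenstein dimension of a module of finite
Gorenstein dimension is at most `depth R - depth X` (`FiniteGDim.extVanish`). Localizing this bound
shows that `Ext^i(X, R)` is supported in height at least `i` (`FiniteGDim.extSupportHeight`), and
then Ischebeck's theorem (`ExtVanish.of_coheight_le`) kills low `Ext` modules out of `Ext^i(X, R)`.

**Maximal Cohen-Macaulay modules** (`FinDeformDim.iff_dual`). Suppose `depth M = d = dim R`. If `M`
lies in `P`, then `Ext^{>0}(M, R) = 0`, so `M^*` lies in `P`. Conversely, if `N = M^*` lies in `P`,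
then so does the cokernel `W` of the dual of a free presentation of `M`. The biduality map of `M`
has kernel `Ext^1(W, R)` and cokernel `Ext^2(W, R)`, and the estimates on the supports of
`Ext^i(W, R)` show that these, and all `Ext^i(N, R)` with `i > 0`, are zero
(`ExtSupportHeight.bijective_dual_eval`). Hence `M ≅ N^*` lies in `P` by duality.

**The general case** (`FinDeformDim.iff_ext`). As `M` is Cohen-Macaulay of dimension `s`,
Ischebeck's theorem gives `Ext^i(M, R) = 0` for `i < d - s`. The `(d - s)`-th syzygy of `M` is
maximal Cohen-Macaulay, and dualizing the resolution relates its dual to `Ext^{d-s}(M, R)` through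
modules in `P`.
-/

/-! ### Vanishing of `Ext` for unbundled modules -/

/-- `Ext^i_R(X, Y) = 0`, for unbundled modules. -/
def ExtVanish (R : Type u) [CommRing R] (X Y : Type u) [AddCommGroup X] [Module R X]
    [AddCommGroup Y] [Module R Y] (i : ℕ) : Prop :=
  Subsingleton (Abelian.Ext (ModuleCat.of R X) (ModuleCat.of R Y) i)

namespace ExtVanish

variable {R : Type u} [CommRing R] {A B C X Y : Type u}
  [AddCommGroup A] [Module R A] [AddCommGroup B] [Module R B] [AddCommGroup C] [Module R C]
  [AddCommGroup X] [Module R X] [AddCommGroup Y] [Module R Y]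

lemma iff_forall {i : ℕ} : ExtVanish R X Y i ↔
    ∀ e : Abelian.Ext (ModuleCat.of R X) (ModuleCat.of R Y) i, e = 0 :=
  ⟨fun h e => @Subsingleton.elim _ h e 0, fun h => ⟨fun a b => (h a).trans (h b).symm⟩⟩

lemma zero_iff : ExtVanish R X Y 0 ↔ ∀ f : X →ₗ[R] Y, f = 0 := by
  have e : Abelian.Ext (ModuleCat.of R X) (ModuleCat.of R Y) 0 ≃ (X →ₗ[R] Y) :=
    Abelian.Ext.homEquiv₀.trans ModuleCat.homEquiv
  rw [ExtVanish, e.subsingleton_congr]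
  exact ⟨fun h f => Subsingleton.elim _ _, fun h => ⟨fun a b => (h a).trans (h b).symm⟩⟩

lemma of_projective [Module.Projective R X] (i : ℕ) : ExtVanish R X Y (i + 1) := by
  have : Projective (ModuleCat.of R X) := (IsProjective.iff_projective X).mp inferInstance
  exact Abelian.Ext.subsingleton_of_projective _ _ _

lemma of_hasProjectiveDimensionLT {n : ℕ} (h : HasProjectiveDimensionLT (ModuleCat.of R X) n)
    {i : ℕ} (hi : n ≤ i) : ExtVanish R X Y i :=
  HasProjectiveDimensionLT.subsingleton _ n i hi _

lemma congr_left (e : X ≃ₗ[R] A) {i : ℕ} (h : ExtVanish R X Y i) : ExtVanish R A Y i := by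
  rw [iff_forall] at h ⊢
  intro x
  have h1 : x = (Abelian.Ext.mk₀ e.symm.toModuleIso.hom).comp
      ((Abelian.Ext.mk₀ e.symm.toModuleIso.inv).comp x (zero_add i)) (zero_add i) := by
    rw [Abelian.Ext.mk₀_comp_mk₀_assoc, Iso.hom_inv_id, Abelian.Ext.mk₀_id_comp]
  rw [h1, h ((Abelian.Ext.mk₀ e.symm.toModuleIso.inv).comp x (zero_add i)),
    Abelian.Ext.comp_zero]

lemma congr_right (e : Y ≃ₗ[R] A) {i : ℕ} (h : ExtVanish R X Y i) : ExtVanish R X A i := by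
  rw [iff_forall] at h ⊢
  intro x
  have h1 : x = (x.comp (Abelian.Ext.mk₀ e.toModuleIso.inv) (add_zero i)).comp
      (Abelian.Ext.mk₀ e.toModuleIso.hom) (add_zero i) := by
    rw [Abelian.Ext.comp_assoc_of_third_deg_zero, Abelian.Ext.mk₀_comp_mk₀, Iso.inv_hom_id,
      Abelian.Ext.comp_mk₀_id]
  rw [h1, h (x.comp (Abelian.Ext.mk₀ e.toModuleIso.inv) (add_zero i)), Abelian.Ext.zero_comp]

end ExtVanish

/-- The short complex attached to a pair of linear maps that is exact in the middle. -/
abbrev Function.Exact.shortComplex {R : Type u} [CommRing R] {A B C : Type u}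
    [AddCommGroup A] [Module R A] [AddCommGroup B] [Module R B] [AddCommGroup C] [Module R C]
    {f : A →ₗ[R] B} {g : B →ₗ[R] C} (h : Function.Exact f g) : ShortComplex (ModuleCat.{u} R) :=
  ModuleCat.shortComplexOfCompEqZero f g h.linearMap_comp_eq_zero

lemma Function.Exact.shortExact {R : Type u} [CommRing R] {A B C : Type u}
    [AddCommGroup A] [Module R A] [AddCommGroup B] [Module R B] [AddCommGroup C] [Module R C]
    {f : A →ₗ[R] B} {g : B →ₗ[R] C} (h : Function.Exact f g) (hf : Function.Injective f)
    (hg : Function.Surjective g) : h.shortComplex.ShortExact :=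
  ModuleCat.shortComplex_shortExact _ h hf hg

/-- The data of a short exact sequence of linear maps. -/
structure IsSES {R : Type u} [CommRing R] {A B C : Type u}
    [AddCommGroup A] [Module R A] [AddCommGroup B] [Module R B] [AddCommGroup C] [Module R C]
    (f : A →ₗ[R] B) (g : B →ₗ[R] C) : Prop where
  inj : Function.Injective f
  exact : Function.Exact f g
  surj : Function.Surjective g

namespace IsSES

variable {R : Type u} [CommRing R] {A B C X Y : Type u}
  [AddCommGroup A] [Module R A] [AddCommGroup B] [Module R B] [AddCommGroup C] [Module R C]
  [AddCommGroup X] [Module R X] [AddCommGroup Y] [Module R Y]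
  {f : A →ₗ[R] B} {g : B →ₗ[R] C}

lemma shortExact (h : IsSES f g) : h.exact.shortComplex.ShortExact :=
  h.exact.shortExact h.inj h.surj

lemma ker (g : B →ₗ[R] C) (hg : Function.Surjective g) : IsSES (LinearMap.ker g).subtype g :=
  ⟨Subtype.val_injective, LinearMap.exact_subtype_ker_map g, hg⟩

lemma mkQ (f : A →ₗ[R] B) (hf : Function.Injective f) : IsSES f (LinearMap.range f).mkQ :=
  ⟨hf, LinearMap.exact_map_mkQ_range f, Submodule.mkQ_surjective _⟩

lemma quotient (N : Submodule R B) : IsSES N.subtype N.mkQ :=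
  ⟨Subtype.val_injective, LinearMap.exact_subtype_mkQ N, Submodule.mkQ_surjective _⟩

lemma covariant_left (h : IsSES f g) {i : ℕ} (h₃ : ExtVanish R X C i)
    (h₂ : ExtVanish R X B (i + 1)) : ExtVanish R X A (i + 1) := by
  rw [ExtVanish.iff_forall] at *
  intro e
  obtain ⟨a, rfl⟩ := Abelian.Ext.covariant_sequence_exact₁ _ h.shortExact e (h₂ _) rfl
  rw [h₃ a, Abelian.Ext.zero_comp]

lemma covariant_left_zero (h : IsSES f g) (h₂ : ExtVanish R X B 0) : ExtVanish R X A 0 := by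
  rw [ExtVanish.zero_iff] at *
  intro φ
  ext x
  exact h.inj (by simpa using LinearMap.congr_fun (h₂ (f ∘ₗ φ)) x)

lemma covariant_right (h : IsSES f g) {i : ℕ} (h₂ : ExtVanish R X B i)
    (h₁ : ExtVanish R X A (i + 1)) : ExtVanish R X C i := by
  rw [ExtVanish.iff_forall] at *
  intro e
  obtain ⟨a, rfl⟩ := Abelian.Ext.covariant_sequence_exact₃ _ h.shortExact e rfl (h₁ _)
  rw [h₂ a, Abelian.Ext.zero_comp]

lemma contravariant_mid (h : IsSES f g) {i : ℕ} (h₁ : ExtVanish R A Y i)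
    (h₃ : ExtVanish R C Y i) : ExtVanish R B Y i := by
  rw [ExtVanish.iff_forall] at *
  intro e
  obtain ⟨a, rfl⟩ := Abelian.Ext.contravariant_sequence_exact₂ h.shortExact _ e (h₁ _)
  rw [h₃ a, Abelian.Ext.comp_zero]

lemma contravariant_left (h : IsSES f g) {i : ℕ} (h₂ : ExtVanish R B Y i)
    (h₃ : ExtVanish R C Y (i + 1)) : ExtVanish R A Y i := by
  rw [ExtVanish.iff_forall] at *
  intro e
  obtain ⟨a, rfl⟩ := Abelian.Ext.contravariant_sequence_exact₁ h.shortExact _ e (add_comm 1 i)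
    (h₃ _)
  rw [h₂ a, Abelian.Ext.comp_zero]

lemma contravariant_right (h : IsSES f g) {i : ℕ} (h₁ : ExtVanish R A Y i)
    (h₂ : ExtVanish R B Y (i + 1)) : ExtVanish R C Y (i + 1) := by
  rw [ExtVanish.iff_forall] at *
  intro e
  obtain ⟨a, rfl⟩ := Abelian.Ext.contravariant_sequence_exact₃ h.shortExact _ e (h₂ _)
    (add_comm 1 i)
  rw [h₁ a, Abelian.Ext.comp_zero]

/-- Dimension shifting: with a projective middle term, `Ext^{i+1}(A, Y) = Ext^{i+2}(C, Y)`. -/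
lemma shift (h : IsSES f g) [Module.Projective R B] {i : ℕ} :
    ExtVanish R A Y (i + 1) ↔ ExtVanish R C Y (i + 2) :=
  ⟨fun h₁ => h.contravariant_right h₁ (.of_projective _),
    fun h₃ => h.contravariant_left (.of_projective _) h₃⟩

/-- If `Ext^1(C, Y) = 0`, every map `A → Y` extends to `B`. -/
lemma exists_extension (h : IsSES f g) (h₃ : ExtVanish R C Y 1) (φ : A →ₗ[R] Y) :
    ∃ ψ : B →ₗ[R] Y, ψ ∘ₗ f = φ := by
  rw [ExtVanish.iff_forall] at h₃
  obtain ⟨a, ha⟩ := Abelian.Ext.contravariant_sequence_exact₁ h.shortExact _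
    (Abelian.Ext.mk₀ (ModuleCat.ofHom φ)) (add_zero 1) (h₃ _)
  obtain ⟨ψ, rfl⟩ := (Abelian.Ext.mk₀_bijective _ _).2 a
  rw [Abelian.Ext.mk₀_comp_mk₀] at ha
  exact ⟨ψ.hom, congrArg ModuleCat.Hom.hom ((Abelian.Ext.mk₀_bijective _ _).1 ha)⟩

/-- If `Ext^1(X, A) = 0`, every map `X → C` lifts to `B`. -/
lemma exists_lift (h : IsSES f g) (h₁ : ExtVanish R X A 1) (φ : X →ₗ[R] C) :
    ∃ ψ : X →ₗ[R] B, g ∘ₗ ψ = φ := by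
  rw [ExtVanish.iff_forall] at h₁
  obtain ⟨a, ha⟩ := Abelian.Ext.covariant_sequence_exact₃ _ h.shortExact
    (Abelian.Ext.mk₀ (ModuleCat.ofHom φ)) (zero_add 1) (h₁ _)
  obtain ⟨ψ, rfl⟩ := (Abelian.Ext.mk₀_bijective _ _).2 a
  rw [Abelian.Ext.mk₀_comp_mk₀] at ha
  exact ⟨ψ.hom, congrArg ModuleCat.Hom.hom ((Abelian.Ext.mk₀_bijective _ _).1 ha)⟩

lemma extVanish_one_iff (h : IsSES f g) [Module.Projective R B] :
    ExtVanish R C Y 1 ↔ ∀ φ : A →ₗ[R] Y, ∃ ψ : B →ₗ[R] Y, ψ ∘ₗ f = φ := by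
  refine ⟨fun h₃ => h.exists_extension h₃, fun H => ?_⟩
  rw [ExtVanish.iff_forall]
  intro e
  obtain ⟨a, rfl⟩ := Abelian.Ext.contravariant_sequence_exact₃ h.shortExact _ e
    (ExtVanish.iff_forall.mp (.of_projective 0) _) (add_zero 1)
  obtain ⟨φ, rfl⟩ := (Abelian.Ext.mk₀_bijective _ _).2 a
  obtain ⟨ψ, hψ⟩ := H φ.hom
  have : φ = h.exact.shortComplex.f ≫ ModuleCat.ofHom ψ := by
    ext x; exact (LinearMap.congr_fun hψ x).symm
  rw [this, ← Abelian.Ext.mk₀_comp_mk₀, h.shortExact.extClass_comp_assoc]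

/-- A short exact sequence `0 → A → B → C → 0` with `Ext^1(C, A) = 0` splits, so `C = 0` if moreover
`Hom(C, B) = 0`. -/
lemma subsingleton_right (h : IsSES f g) (h₁ : ExtVanish R C A 1) (h₂ : ExtVanish R C B 0) :
    Subsingleton C := by
  have := ExtVanish.zero_iff.mp (h.covariant_right h₂ h₁) LinearMap.id
  exact ⟨fun a b => by
    rw [← LinearMap.id_apply (R := R) a, ← LinearMap.id_apply (R := R) b, this]; rfl⟩

/-- The dual of a short exact sequence whose last term has `Ext^1(C, R) = 0`. -/
lemma dual (h : IsSES f g) (h₃ : ExtVanish R C R 1) : IsSES g.dualMap f.dualMap :=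
  ⟨LinearMap.dualMap_injective_of_surjective h.surj,
    LinearMap.exact_lcomp_of_exact_of_surjective R h.exact h.surj,
    fun φ => h.exists_extension h₃ φ⟩

end IsSES

namespace ExtVanish

variable {R : Type u} [CommRing R] {X Y : Type u}
  [AddCommGroup X] [Module R X] [AddCommGroup Y] [Module R Y]

lemma of_subsingleton_left [Subsingleton X] (i : ℕ) : ExtVanish R X Y i := by
  cases i with
  | zero => exact zero_iff.mpr fun f => Subsingleton.elim _ _
  | succ i =>
    have : Module.Projective R X := Module.Projective.of_free
    exact of_projective i

/-- An element of `Ext^i(X, Y^n)` is determined by its components. -/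
lemma _root_.eq_zero_of_forall_comp_proj {n i : ℕ}
    (e : Abelian.Ext (ModuleCat.of R X) (ModuleCat.of R (Fin n → Y)) i)
    (h : ∀ j, e.comp (Abelian.Ext.mk₀ (ModuleCat.ofHom
      (LinearMap.proj (R := R) (φ := fun _ : Fin n => Y) j))) (add_zero i) = 0) : e = 0 := by
  have hid : 𝟙 (ModuleCat.of R (Fin n → Y)) =
      ∑ j, ModuleCat.ofHom (LinearMap.proj (φ := fun _ => Y) j) ≫
        ModuleCat.ofHom (LinearMap.single R (fun _ => Y) j) := by
    apply ModuleCat.hom_ext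
    simp only [ModuleCat.hom_id, ModuleCat.hom_sum, ModuleCat.hom_comp, ModuleCat.hom_ofHom]
    refine LinearMap.ext fun x => ?_
    rw [LinearMap.sum_apply]
    exact (LinearMap.sum_single_apply (fun _ => Y) x).symm
  rw [← Abelian.Ext.comp_mk₀_id e, hid, Abelian.Ext.mk₀_sum, Abelian.Ext.comp_sum]
  refine Finset.sum_eq_zero fun j _ => ?_
  rw [← Abelian.Ext.mk₀_comp_mk₀, ← Abelian.Ext.comp_assoc_of_second_deg_zero, h j,
    Abelian.Ext.zero_comp]

lemma pi {n i : ℕ} (h : ExtVanish R X Y i) : ExtVanish R X (Fin n → Y) i :=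
  iff_forall.mpr fun e => eq_zero_of_forall_comp_proj e fun _ => iff_forall.mp h _

end ExtVanish

/-! ### Finite projective dimension -/

/-- The `Q`-module `Y` has finite projective dimension. -/
def FinProjDim (Q : Type u) [CommRing Q] (Y : Type u) [AddCommGroup Y] [Module Q Y] : Prop :=
  ∃ n, HasProjectiveDimensionLT (ModuleCat.of Q Y) n

namespace FinProjDim

variable {Q : Type u} [CommRing Q] {A B C : Type u}
  [AddCommGroup A] [Module Q A] [AddCommGroup B] [Module Q B] [AddCommGroup C] [Module Q C]
  {f : A →ₗ[Q] B} {g : B →ₗ[Q] C}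

lemma of_projective [Module.Projective Q A] : FinProjDim Q A :=
  have : Projective (ModuleCat.of Q A) := (IsProjective.iff_projective A).mp inferInstance
  ⟨1, inferInstance⟩

lemma congr (e : A ≃ₗ[Q] B) (h : FinProjDim Q A) : FinProjDim Q B := by
  obtain ⟨n, hn⟩ := h
  exact ⟨n, hasProjectiveDimensionLT_of_iso e.toModuleIso n⟩

lemma mid (h : IsSES f g) (h₁ : FinProjDim Q A) (h₃ : FinProjDim Q C) : FinProjDim Q B := by
  obtain ⟨n, hn⟩ := h₁
  obtain ⟨m, hm⟩ := h₃
  exact ⟨max n m, h.shortExact.hasProjectiveDimensionLT_X₂ _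
    (hasProjectiveDimensionLT_of_ge _ n _ (le_max_left _ _))
    (hasProjectiveDimensionLT_of_ge _ m _ (le_max_right _ _))⟩

lemma right (h : IsSES f g) (h₁ : FinProjDim Q A) (h₂ : FinProjDim Q B) : FinProjDim Q C := by
  obtain ⟨n, hn⟩ := h₁
  obtain ⟨m, hm⟩ := h₂
  exact ⟨max n m + 1, h.shortExact.hasProjectiveDimensionLT_X₃ _
    (hasProjectiveDimensionLT_of_ge _ n _ (le_max_left _ _))
    (hasProjectiveDimensionLT_of_ge _ m _ ((le_max_right _ _).trans (Nat.le_succ _)))⟩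

lemma left (h : IsSES f g) (h₂ : FinProjDim Q B) (h₃ : FinProjDim Q C) : FinProjDim Q A := by
  obtain ⟨n, hn⟩ := h₂
  obtain ⟨m, hm⟩ := h₃
  exact ⟨max n m, h.shortExact.hasProjectiveDimensionLT_X₁ _
    (hasProjectiveDimensionLT_of_ge _ n _ (le_max_left _ _))
    (hasProjectiveDimensionLT_of_ge _ m _ ((le_max_right _ _).trans (Nat.le_succ _)))⟩

lemma pi (h : FinProjDim Q A) (m : ℕ) : FinProjDim Q (Fin m → A) := by
  induction m with
  | zero =>
    have : Module.Projective Q (Fin 0 → A) := Module.Projective.of_free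
    exact of_projective
  | succ m ih =>
    have e : (A × (Fin m → A)) ≃ₗ[Q] (Fin (m + 1) → A) := Fin.consLinearEquiv Q (fun _ => A)
    exact (mid (f := LinearMap.inl Q A (Fin m → A)) (g := LinearMap.snd Q A (Fin m → A))
      ⟨LinearMap.inl_injective, .inl_snd, LinearMap.snd_surjective⟩ h ih).congr e

end FinProjDim

lemma IsSES.restrictScalars (Q : Type u) [CommRing Q] {A : Type u} [CommRing A] [Algebra Q A]
    {X Y Z : Type u} [AddCommGroup X] [Module A X] [Module Q X] [IsScalarTower Q A X]
    [AddCommGroup Y] [Module A Y] [Module Q Y] [IsScalarTower Q A Y]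
    [AddCommGroup Z] [Module A Z] [Module Q Z] [IsScalarTower Q A Z]
    {f : X →ₗ[A] Y} {g : Y →ₗ[A] Z} (h : IsSES f g) :
    IsSES (f.restrictScalars Q) (g.restrictScalars Q) :=
  ⟨h.inj, h.exact, h.surj⟩

/-! ### The first `Ext` module as a quotient of a dual -/

namespace IsSES

variable {R : Type u} [CommRing R] {A B C Y : Type u}
  [AddCommGroup A] [Module R A] [AddCommGroup B] [Module R B] [AddCommGroup C] [Module R C]
  [AddCommGroup Y] [Module R Y] {f : A →ₗ[R] B} {g : B →ₗ[R] C}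

/-- The connecting homomorphism `Hom(A, Y) → Ext^1(C, Y)` of a short exact sequence. -/
noncomputable def connecting (h : IsSES f g) (Y : Type u) [AddCommGroup Y] [Module R Y] :
    (A →ₗ[R] Y) →ₗ[R] Abelian.Ext (ModuleCat.of R C) (ModuleCat.of R Y) 1 :=
  h.shortExact.extClass.precompOfLinear R (ModuleCat.of R Y) (add_zero 1) ∘ₗ
    (Abelian.Ext.linearEquiv₀.trans ModuleCat.homLinearEquiv).symm.toLinearMap

lemma connecting_apply (h : IsSES f g) (φ : A →ₗ[R] Y) :
    h.connecting Y φ = h.shortExact.extClass.comp (Abelian.Ext.mk₀ (ModuleCat.ofHom φ))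
      (add_zero 1) := rfl

lemma connecting_surjective (h : IsSES f g) [Module.Projective R B] :
    Function.Surjective (h.connecting Y) := by
  intro e
  obtain ⟨a, rfl⟩ := Abelian.Ext.contravariant_sequence_exact₃ h.shortExact _ e
    (ExtVanish.iff_forall.mp (.of_projective 0) _) (add_zero 1)
  obtain ⟨φ, rfl⟩ := (Abelian.Ext.mk₀_bijective _ _).2 a
  exact ⟨φ.hom, rfl⟩

lemma connecting_eq_zero_iff (h : IsSES f g) (φ : A →ₗ[R] Y) :
    h.connecting Y φ = 0 ↔ ∃ ψ : B →ₗ[R] Y, ψ ∘ₗ f = φ := by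
  rw [connecting_apply]
  refine ⟨fun H => ?_, ?_⟩
  · obtain ⟨a, ha⟩ := Abelian.Ext.contravariant_sequence_exact₁ h.shortExact _
      (Abelian.Ext.mk₀ (ModuleCat.ofHom φ)) (add_zero 1) H
    obtain ⟨ψ, rfl⟩ := (Abelian.Ext.mk₀_bijective _ _).2 a
    rw [Abelian.Ext.mk₀_comp_mk₀] at ha
    exact ⟨ψ.hom, congrArg ModuleCat.Hom.hom ((Abelian.Ext.mk₀_bijective _ _).1 ha)⟩
  · rintro ⟨ψ, rfl⟩
    have : ModuleCat.ofHom (ψ ∘ₗ f) = h.exact.shortComplex.f ≫ ModuleCat.ofHom ψ := rfl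
    rw [this, ← Abelian.Ext.mk₀_comp_mk₀, h.shortExact.extClass_comp_assoc]

/-- The higher connecting isomorphism `Ext^{i+1}(A, Y) ≃ Ext^{i+2}(C, Y)`. -/
noncomputable def shiftEquiv (h : IsSES f g) [Module.Projective R B] (Y : Type u)
    [AddCommGroup Y] [Module R Y] (i : ℕ) :
    Abelian.Ext (ModuleCat.of R A) (ModuleCat.of R Y) (i + 1) ≃ₗ[R]
      Abelian.Ext (ModuleCat.of R C) (ModuleCat.of R Y) (i + 2) :=
  LinearEquiv.ofBijective
    (h.shortExact.extClass.precompOfLinear R (ModuleCat.of R Y) (add_comm 1 (i + 1))) <| by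
    constructor
    · rw [injective_iff_map_eq_zero]
      intro x hx
      obtain ⟨a, rfl⟩ := Abelian.Ext.contravariant_sequence_exact₁ h.shortExact _ x
        (add_comm 1 (i + 1)) hx
      rw [ExtVanish.iff_forall.mp (.of_projective i) a, Abelian.Ext.comp_zero]
    · intro e
      exact Abelian.Ext.contravariant_sequence_exact₃ h.shortExact _ e
        (ExtVanish.iff_forall.mp (.of_projective (i + 1)) _) (add_comm 1 (i + 1))

end IsSES

/-! ### Passing to the quotient by a regular element -/

section OneElement

variable {A A₁ : Type u} [CommRing A] [CommRing A₁] [Algebra A A₁] {x : A}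

lemma isSES_mul_algebraMap (hx : IsSMulRegular A x)
    (hs : Function.Surjective (algebraMap A A₁))
    (hk : RingHom.ker (algebraMap A A₁) = Ideal.span {x}) :
    IsSES (x • LinearMap.id : A →ₗ[A] A) (Algebra.linearMap A A₁) := by
  refine ⟨hx, fun a => ?_, hs⟩
  rw [Algebra.linearMap_apply, ← RingHom.mem_ker, hk, Ideal.mem_span_singleton']
  exact ⟨fun ⟨c, hc⟩ => ⟨c, by simpa [mul_comm] using hc⟩,
    fun ⟨c, hc⟩ => ⟨c, by simpa [mul_comm] using hc⟩⟩

lemma extVanish_pi_quotient {Z : Type u} [AddCommGroup Z] [Module A Z]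
    (hx : IsSMulRegular A x)
    (hs : Function.Surjective (algebraMap A A₁))
    (hk : RingHom.ker (algebraMap A A₁) = Ideal.span {x}) (m i : ℕ) :
    ExtVanish A (Fin m → A₁) Z (i + 2) := by
  have h : ExtVanish A A₁ Z (i + 2) :=
    (isSES_mul_algebraMap hx hs hk).contravariant_right (.of_projective _) (.of_projective _)
  induction m with
  | zero => exact .of_subsingleton_left _
  | succ m ih =>
    exact .congr_left (Fin.consLinearEquiv A (fun _ => A₁)) <|
      IsSES.contravariant_mid (f := LinearMap.inl A A₁ (Fin m → A₁))
        (g := LinearMap.snd A A₁ (Fin m → A₁))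
        ⟨LinearMap.inl_injective, .inl_snd, LinearMap.snd_surjective⟩ h ih

variable {Y : Type u} [AddCommGroup Y] [Module A Y] [Module A₁ Y] [IsScalarTower A A₁ Y]

lemma smul_eq_zero_of_algebraMap_ker (hk : RingHom.ker (algebraMap A A₁) = Ideal.span {x})
    (y : Y) : x • y = 0 := by
  have : algebraMap A A₁ x = 0 := by
    rw [← RingHom.mem_ker, hk]; exact Ideal.mem_span_singleton_self x
  rw [← algebraMap_smul A₁ x y, this, zero_smul]

lemma extVanish_zero_of_regular (hx : IsSMulRegular A x)
    (hk : RingHom.ker (algebraMap A A₁) = Ideal.span {x}) : ExtVanish A Y A 0 := by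
  rw [ExtVanish.zero_iff]
  intro φ
  ext y
  refine hx ?_
  change x • φ y = x • 0
  rw [← map_smul, smul_eq_zero_of_algebraMap_ker hk y, map_zero, smul_zero]

/-- For an `A/x`-module `Y`, the connecting map `Hom(Y, A/x) → Ext^1_A(Y, A)` is bijective. -/
noncomputable def homEquivExtOne (hx : IsSMulRegular A x)
    (hs : Function.Surjective (algebraMap A A₁))
    (hk : RingHom.ker (algebraMap A A₁) = Ideal.span {x}) :
    (Y →ₗ[A] A₁) ≃ₗ[A] Abelian.Ext (ModuleCat.of A Y) (ModuleCat.of A A) 1 :=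
  LinearEquiv.ofBijective
    ((isSES_mul_algebraMap hx hs hk).shortExact.extClass.postcompOfLinear A (ModuleCat.of A Y)
        (zero_add 1) ∘ₗ
      (Abelian.Ext.linearEquiv₀.trans ModuleCat.homLinearEquiv).symm.toLinearMap) <| by
    constructor
    · rw [injective_iff_map_eq_zero]
      intro φ hφ
      obtain ⟨a, ha⟩ := Abelian.Ext.covariant_sequence_exact₃ _
        (isSES_mul_algebraMap hx hs hk).shortExact (Abelian.Ext.mk₀ (ModuleCat.ofHom φ)) (zero_add 1) hφ
      rw [ExtVanish.iff_forall.mp (extVanish_zero_of_regular (Y := Y) hx hk) a,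
        Abelian.Ext.zero_comp] at ha
      exact congrArg ModuleCat.Hom.hom
        ((Abelian.Ext.mk₀_eq_zero_iff _).mp ha.symm)
    · intro e
      have hann : x ∈ Module.annihilator A (ModuleCat.of A Y) :=
        Module.mem_annihilator.mpr fun y => smul_eq_zero_of_algebraMap_ker hk y
      obtain ⟨a, rfl⟩ := Abelian.Ext.covariant_sequence_exact₁ _
        (isSES_mul_algebraMap hx hs hk).shortExact e
        (DFunLike.congr_fun (congrArg AddCommGrpCat.Hom.hom
          (Abelian.Ext.postcomp_smul_id_eq_zero_of_mem_annihilator (M := ModuleCat.of A A) hann 1)) e)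
        (zero_add 1)
      obtain ⟨φ, rfl⟩ := (Abelian.Ext.mk₀_bijective _ _).2 a
      exact ⟨φ.hom, rfl⟩

lemma homEquivExtOne_apply (hx : IsSMulRegular A x)
    (hs : Function.Surjective (algebraMap A A₁))
    (hk : RingHom.ker (algebraMap A A₁) = Ideal.span {x}) (φ : Y →ₗ[A] A₁) :
    homEquivExtOne hx hs hk φ = (Abelian.Ext.mk₀ (ModuleCat.ofHom φ)).comp
      (isSES_mul_algebraMap hx hs hk).shortExact.extClass (zero_add 1) := rfl

/-- Rees' change of rings, for the vanishing of `Ext^{i+1}_{A/x}(Y, A/x) = Ext^{i+2}_A(Y, A)`. -/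
theorem extVanish_quotient_iff [IsNoetherianRing A₁] [Module.Finite A₁ Y] (hx : IsSMulRegular A x)
    (hs : Function.Surjective (algebraMap A A₁))
    (hk : RingHom.ker (algebraMap A A₁) = Ideal.span {x}) (i : ℕ) :
    ExtVanish A₁ Y A₁ (i + 1) ↔ ExtVanish A Y A (i + 2) := by
  induction i generalizing Y with
  | zero =>
    obtain ⟨m, π, hπ⟩ := Module.Finite.exists_fin' A₁ Y
    have h₁ := IsSES.ker π hπ
    have h := h₁.restrictScalars A
    rw [h₁.extVanish_one_iff]
    refine ⟨fun H => ?_, fun H φ => ?_⟩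
    · rw [ExtVanish.iff_forall]
      intro e
      obtain ⟨a, rfl⟩ := Abelian.Ext.contravariant_sequence_exact₃ h.shortExact _ e
        (ExtVanish.iff_forall.mp
          (extVanish_pi_quotient hx hs hk m 0) _) (add_comm 1 1)
      obtain ⟨φ, rfl⟩ := (homEquivExtOne hx hs hk).surjective a
      obtain ⟨ψ, hψ⟩ := H (φ.extendScalarsOfSurjective hs)
      have : ModuleCat.ofHom φ = h.exact.shortComplex.f ≫
          ModuleCat.ofHom (ψ.restrictScalars A) := by
        ext y; exact (LinearMap.congr_fun hψ y).symm
      rw [homEquivExtOne_apply, this, ← Abelian.Ext.mk₀_comp_mk₀,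
        Abelian.Ext.comp_assoc_of_second_deg_zero, h.shortExact.extClass_comp_assoc]
    · obtain ⟨b, hb⟩ := Abelian.Ext.contravariant_sequence_exact₁ h.shortExact _
        (homEquivExtOne hx hs hk (φ.restrictScalars A)) (add_comm 1 1)
        (ExtVanish.iff_forall.mp H _)
      obtain ⟨ψ, rfl⟩ := (homEquivExtOne hx hs hk).surjective b
      refine ⟨ψ.extendScalarsOfSurjective hs, ?_⟩
      have : φ.restrictScalars A = ψ ∘ₗ (LinearMap.ker π).subtype.restrictScalars A := by
        refine (homEquivExtOne hx hs hk).injective ?_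
        rw [← hb]
        simp only [homEquivExtOne_apply]
        rw [Abelian.Ext.mk₀_comp_mk₀_assoc]
        rfl
      ext y
      exact (LinearMap.congr_fun this y).symm
  | succ i ih =>
    obtain ⟨m, π, hπ⟩ := Module.Finite.exists_fin' A₁ Y
    have h₁ := IsSES.ker π hπ
    have h := h₁.restrictScalars A
    rw [← h₁.shift, ih]
    exact ⟨fun H => h.contravariant_right H
        (extVanish_pi_quotient hx hs hk m _),
      fun H => h.contravariant_left (extVanish_pi_quotient hx hs hk m _) H⟩

end OneElement

/-! ### Duality for modules of finite projective dimension over a deformation -/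

/-- Duality over an algebra `A` for the modules of finite projective dimension over `Q`: if `Y` is
such a module, then `Ext^i_A(Y, A)` vanishes for large `i`, and if it vanishes for all `i > 0`, then
the dual of `Y` is a module of the same kind. -/
structure HasFinProjDimDuality (Q A : Type u) [CommRing Q] [CommRing A] [Algebra Q A] : Prop where
  finProjDim : FinProjDim Q A
  dual : ∀ (Y : Type u) [AddCommGroup Y] [Module A Y] [Module Q Y] [IsScalarTower Q A Y]
    [Module.Finite A Y], FinProjDim Q Y → (∀ i, ExtVanish A Y A (i + 1)) →
      FinProjDim Q (Module.Dual A Y) ∧ ∀ i, ExtVanish A (Module.Dual A Y) A (i + 1)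
  bounded : ∀ (Y : Type u) [AddCommGroup Y] [Module A Y] [Module Q Y] [IsScalarTower Q A Y]
    [Module.Finite A Y], FinProjDim Q Y → ∃ t, ∀ i, t ≤ i → ExtVanish A Y A (i + 1)

lemma FinProjDim.of_semilinear {Q A : Type u} [CommRing Q] [CommRing A] (e : Q ≃+* A)
    {X Y : Type u} [AddCommGroup X] [Module Q X] [AddCommGroup Y] [Module A Y] (e' : X ≃+ Y)
    (he : ∀ (q : Q) (x : X), e' (q • x) = e q • e' x) (h : FinProjDim Q X) : FinProjDim A Y := by
  obtain ⟨n, hn⟩ := h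
  let := RingHomInvPair.of_ringEquiv e
  let := RingHomInvPair.symm (RingHomClass.toRingHom e) (RingHomClass.toRingHom e.symm)
  let e'' : X ≃ₛₗ[RingHomClass.toRingHom e] Y := { e' with map_smul' := he }
  have : HasProjectiveDimensionLE (ModuleCat.of Q X) n :=
    hasProjectiveDimensionLT_of_ge _ n (n + 1) n.le_succ
  exact ⟨n + 1, ModuleCat.hasProjectiveDimensionLE_of_semiLinearEquiv
    (M := ModuleCat.of Q X) (N := ModuleCat.of A Y) e e'' n⟩

/-- A finite module of finite projective dimension with `Ext^{>0}(Y, A) = 0` is projective. -/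
lemma projective_of_finProjDim {A : Type u} [CommRing A] [IsNoetherianRing A] {Y : Type u}
    [AddCommGroup Y] [Module A Y] [Module.Finite A Y] (h : FinProjDim A Y)
    (hY : ∀ i, ExtVanish A Y A (i + 1)) : Module.Projective A Y := by
  obtain ⟨n, hn⟩ := h
  induction n generalizing Y with
  | zero =>
    have : Subsingleton Y := ModuleCat.isZero_iff_subsingleton.mp
      (isZero_of_hasProjectiveDimensionLT_zero (ModuleCat.of A Y))
    exact Module.Projective.of_free
  | succ n ih =>
    obtain ⟨m, π, hπ⟩ := Module.Finite.exists_fin' A Y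
    have h := IsSES.ker π hπ
    rcases n with _ | n
    · exact (IsProjective.iff_projective Y).mpr
        (projective_iff_hasProjectiveDimensionLT_one.mpr hn)
    have hK : Module.Projective A (LinearMap.ker π) := by
      refine ih (fun i => h.shift.mpr (hY _)) ?_
      exact (h.shortExact.hasProjectiveDimensionLT_X₃_iff n
        ((IsProjective.iff_projective (Fin m → A)).mp inferInstance)).mp hn
    have hYK : ExtVanish A Y (LinearMap.ker π) 1 := by
      -- the kernel, being projective, is a direct summand of a free module
      obtain ⟨r, ρ, hρ⟩ := Module.Finite.exists_fin' A (LinearMap.ker π)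
      obtain ⟨σ, hσ⟩ := Module.projective_lifting_property ρ LinearMap.id hρ
      rw [ExtVanish.iff_forall]
      intro e
      have h0 := ExtVanish.iff_forall.mp (hY 0).pi
        (e.comp (Abelian.Ext.mk₀ (ModuleCat.ofHom σ)) (add_zero 1))
      have h1 : (e.comp (Abelian.Ext.mk₀ (ModuleCat.ofHom σ)) (add_zero 1)).comp
          (Abelian.Ext.mk₀ (ModuleCat.ofHom ρ)) (add_zero 1) = e := by
        rw [Abelian.Ext.comp_assoc_of_third_deg_zero, Abelian.Ext.mk₀_comp_mk₀,
          ← ModuleCat.ofHom_comp, hσ, ModuleCat.ofHom_id, Abelian.Ext.comp_mk₀_id]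
      rw [← h1, h0, Abelian.Ext.zero_comp]
    obtain ⟨σ, hσ⟩ := h.exists_lift hYK LinearMap.id
    exact Module.Projective.of_split σ π hσ

variable {Q A : Type u} [CommRing Q] [CommRing A] [Algebra Q A]

lemma HasFinProjDimDuality.of_bijective [IsNoetherianRing A]
    (h : Function.Bijective (algebraMap Q A)) : HasFinProjDimDuality Q A := by
  let e : Q ≃+* A := RingEquiv.ofBijective (algebraMap Q A) h
  have key : ∀ (Y : Type u) [AddCommGroup Y] [Module A Y] [Module Q Y] [IsScalarTower Q A Y],
      FinProjDim Q Y ↔ FinProjDim A Y := fun Y _ _ _ _ =>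
    ⟨fun H => H.of_semilinear e (.refl Y) fun q y => (algebraMap_smul A q y).symm,
      fun H => H.of_semilinear e.symm (.refl Y) fun a y => by
        obtain ⟨q, rfl⟩ := e.surjective a
        rw [e.symm_apply_apply]
        exact algebraMap_smul A q y⟩
  refine ⟨(key A).mpr .of_projective, fun Y _ _ _ _ _ hY H => ?_, fun Y _ _ _ _ _ hY => ?_⟩
  · have := projective_of_finProjDim ((key Y).mp hY) H
    exact ⟨(key _).mpr .of_projective, fun i => .of_projective i⟩
  · obtain ⟨n, hn⟩ := (key Y).mp hY
    exact ⟨n, fun i hi => .of_hasProjectiveDimensionLT hn (hi.trans i.le_succ)⟩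

/-- Duality passes from `A` to `A₁ = A / x` for a regular element `x`. If `Y` is an `A₁`-module with
`Ext^{>0}(Y, A₁) = 0`, a syzygy `K` of `Y` over `A` has `Ext^{>0}(K, A) = 0`, and the sequence
`0 → F^* → K^* → Ext^1_A(Y, A) → 0`, whose last term is `Hom(Y, A₁)`, carries the result over. -/
lemma HasFinProjDimDuality.quotient {A₁ : Type u} [CommRing A₁] [Algebra A A₁] [Algebra Q A₁]
    [IsScalarTower Q A A₁] [IsNoetherianRing A] [IsNoetherianRing A₁] {x : A}
    (hx : IsSMulRegular A x) (hs : Function.Surjective (algebraMap A A₁))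
    (hk : RingHom.ker (algebraMap A A₁) = Ideal.span {x}) (h : HasFinProjDimDuality Q A) :
    HasFinProjDimDuality Q A₁ := by
  have hfin : Module.Finite A A₁ := Module.Finite.of_surjective (Algebra.linearMap A A₁) hs
  refine ⟨.right ((isSES_mul_algebraMap hx hs hk).restrictScalars Q) h.finProjDim h.finProjDim,
    fun Y _ _ _ _ _ hY H => ?_, fun Y _ _ _ _ _ hY => ?_⟩
  · let : Module A Y := Module.compHom Y (algebraMap A A₁)
    have t₁ : IsScalarTower A A₁ Y := ⟨fun a b y => by
      rw [Algebra.smul_def, mul_smul]; rfl⟩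
    have t₂ : IsScalarTower Q A Y := ⟨fun q a y => by
      rw [← algebraMap_smul A₁ (q • a) y, ← algebraMap_smul A₁ a y, Algebra.smul_def, map_mul,
        mul_smul, ← IsScalarTower.algebraMap_apply, algebraMap_smul]⟩
    have hfinY : Module.Finite A Y := Module.Finite.trans A₁ Y
    obtain ⟨m, π, hπ⟩ := Module.Finite.exists_fin' A Y
    have ses := IsSES.ker π hπ
    have hAY : ∀ i, ExtVanish A Y A (i + 2) := fun i =>
      (extVanish_quotient_iff hx hs hk i).mp (H i)
    obtain ⟨hD, hE⟩ := h.dual (LinearMap.ker π)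
      (.left (ses.restrictScalars Q) (h.finProjDim.pi m) hY) (fun i => ses.shift.mpr (hAY i))
    let c : (Y →ₗ[A] A₁) ≃ₗ[A] (Y →ₗ[A₁] A₁) :=
      { toFun φ := φ.extendScalarsOfSurjective hs
        invFun φ := φ.restrictScalars A
        map_add' _ _ := rfl
        map_smul' _ _ := rfl
        left_inv _ := rfl
        right_inv _ := rfl }
    have ses' : IsSES (LinearMap.ker π).subtype.dualMap
        (((homEquivExtOne (Y := Y) hx hs hk).symm.trans c).toLinearMap ∘ₗ ses.connecting A) := by
      refine ⟨?_, fun φ => ?_, ?_⟩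
      · rw [injective_iff_map_eq_zero]
        intro ψ hψ
        have hex := LinearMap.exact_lcomp_of_exact_of_surjective A ses.exact ses.surj
        obtain ⟨ω, rfl⟩ := (hex ψ).mp hψ
        rw [ExtVanish.zero_iff.mp (extVanish_zero_of_regular (Y := Y) hx hk) ω, map_zero]
      · rw [LinearMap.comp_apply, LinearEquiv.coe_coe, LinearEquiv.map_eq_zero_iff,
          ses.connecting_eq_zero_iff]
        rfl
      · rw [LinearMap.coe_comp]
        exact (LinearEquiv.surjective _).comp ses.connecting_surjective
    have hF : FinProjDim Q (Module.Dual A (Fin m → A)) :=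
      (h.finProjDim.pi m).congr ((Module.piEquiv (Fin m) A A).restrictScalars Q)
    refine ⟨.right (ses'.restrictScalars Q) hF hD, fun i => ?_⟩
    exact (extVanish_quotient_iff hx hs hk i).mpr
      (ses'.contravariant_right (.of_projective i) (hE (i + 1)))
  · let : Module A Y := Module.compHom Y (algebraMap A A₁)
    have t₁ : IsScalarTower A A₁ Y := ⟨fun a b y => by
      rw [Algebra.smul_def, mul_smul]; rfl⟩
    have t₂ : IsScalarTower Q A Y := ⟨fun q a y => by
      rw [← algebraMap_smul A₁ (q • a) y, ← algebraMap_smul A₁ a y, Algebra.smul_def, map_mul,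
        mul_smul, ← IsScalarTower.algebraMap_apply, algebraMap_smul]⟩
    have hfinY : Module.Finite A Y := Module.Finite.trans A₁ Y
    obtain ⟨t, ht⟩ := h.bounded Y hY
    exact ⟨t, fun i hi => (extVanish_quotient_iff hx hs hk i).mpr (ht _ (by omega))⟩

/-- A quotient of a Noetherian ring by a weakly regular sequence has the duality property. -/
theorem HasFinProjDimDuality.of_isWeaklyRegular [IsNoetherianRing Q] (rs : List Q)
    (hrs : RingTheory.Sequence.IsWeaklyRegular Q rs) (A : Type u) [CommRing A] [Algebra Q A]
    (hs : Function.Surjective (algebraMap Q A))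
    (hk : RingHom.ker (algebraMap Q A) = Ideal.ofList rs) : HasFinProjDimDuality Q A := by
  induction rs using List.reverseRecOn generalizing A with
  | nil =>
    have : IsNoetherianRing A := isNoetherianRing_of_surjective _ _ (algebraMap Q A) hs
    refine .of_bijective ⟨?_, hs⟩
    rw [RingHom.injective_iff_ker_eq_bot, hk, Ideal.ofList_nil]
  | append_singleton rs x ih =>
    rw [RingTheory.Sequence.isWeaklyRegular_append_iff] at hrs
    have hA' := ih hrs.1 (Q ⧸ Ideal.ofList rs) Ideal.Quotient.mk_surjective Ideal.mk_ker
    have hle : Ideal.ofList rs ≤ RingHom.ker (algebraMap Q A) := by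
      rw [hk, Ideal.ofList_append]; exact le_sup_left
    let : Algebra (Q ⧸ Ideal.ofList rs) A :=
      (Ideal.Quotient.lift (Ideal.ofList rs) (algebraMap Q A) fun a ha => hle ha).toAlgebra
    have : IsScalarTower Q (Q ⧸ Ideal.ofList rs) A := .of_algebraMap_eq fun q => rfl
    have : IsNoetherianRing A := isNoetherianRing_of_surjective _ _ (algebraMap Q A) hs
    refine hA'.quotient (x := Ideal.Quotient.mk _ x) ?_ ?_ ?_
    · rw [smul_eq_mul, Ideal.mul_top, RingTheory.Sequence.isWeaklyRegular_singleton_iff] at hrs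
      exact fun a b hab => hrs.2 (by simpa [Algebra.smul_def] using hab)
    · intro a
      obtain ⟨q, rfl⟩ := hs a
      exact ⟨Ideal.Quotient.mk _ q, rfl⟩
    · have h1 : RingHom.ker (algebraMap (Q ⧸ Ideal.ofList rs) A) =
          (RingHom.ker (algebraMap Q A)).map (Ideal.Quotient.mk (Ideal.ofList rs)) :=
        Ideal.ker_quotient_lift _ hle
      rw [h1, hk, Ideal.ofList_append, Ideal.map_sup, Ideal.map_quotient_self, bot_sup_eq,
        Ideal.ofList_singleton, Ideal.map_span, Set.image_singleton]

/-! ### Flat base change -/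

open scoped TensorProduct

lemma IsSES.congr_mid {R : Type u} [CommRing R] {A B C B' : Type u}
    [AddCommGroup A] [Module R A] [AddCommGroup B]
    [Module R B] [AddCommGroup C] [Module R C] [AddCommGroup B'] [Module R B']
    {f : A →ₗ[R] B} {g : B →ₗ[R] C} (h : IsSES f g) (e : B ≃ₗ[R] B') :
    IsSES (e.toLinearMap ∘ₗ f) (g ∘ₗ e.symm.toLinearMap) :=
  ⟨e.injective.comp h.inj, by
    intro b
    simp only [LinearMap.comp_apply, LinearEquiv.coe_coe, Set.mem_range]
    rw [h.exact]
    exact ⟨fun ⟨a, ha⟩ => ⟨a, by simp [ha]⟩, fun ⟨a, ha⟩ => ⟨a, by simp [← ha]⟩⟩,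
    h.surj.comp e.symm.surjective⟩

section FlatBaseChange

variable {R : Type u} [CommRing R] (S : Type u) [CommRing S] [Algebra R S] [Module.Flat R S]
  {A B C X : Type u} [AddCommGroup A] [Module R A] [AddCommGroup B] [Module R B]
  [AddCommGroup C] [Module R C] [AddCommGroup X] [Module R X]
  {f : A →ₗ[R] B} {g : B →ₗ[R] C}

lemma IsSES.baseChange (h : IsSES f g) : IsSES (f.baseChange S) (g.baseChange S) :=
  ⟨Module.Flat.lTensor_preserves_injective_linearMap f h.inj,
    lTensor_exact S h.exact h.surj, LinearMap.lTensor_surjective S h.surj⟩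

variable [IsNoetherianRing R]

variable (X) in
/-- The dual of a finite module commutes with flat base change. -/
noncomputable def dualBaseChange [Module.Finite R X] :
    S ⊗[R] Module.Dual R X ≃ₗ[S] Module.Dual S (S ⊗[R] X) :=
  have : Module.FinitePresentation R X := Module.finitePresentation_of_finite R X
  (Module.FinitePresentation.isBaseChange_map R X R S).equiv.trans
    (LinearEquiv.congrRight (TensorProduct.AlgebraTensorModule.rid R S S))

@[simp]
lemma dualBaseChange_tmul [Module.Finite R X] (s t : S) (φ : Module.Dual R X) (x : X) :
    dualBaseChange S X (s ⊗ₜ φ) (t ⊗ₜ x) = s * (φ x • t) := by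
  have : Module.FinitePresentation R X := Module.finitePresentation_of_finite R X
  simp only [dualBaseChange, LinearEquiv.trans_apply, IsBaseChange.equiv_tmul, map_smul,
    LinearMap.smul_apply, smul_eq_mul]
  rfl

lemma dualBaseChange_dualMap [Module.Finite R A] [Module.Finite R B] (z : S ⊗[R] Module.Dual R B) :
    dualBaseChange S A (f.dualMap.baseChange S z) =
      (f.baseChange S).dualMap (dualBaseChange S B z) := by
  induction z with
  | zero => simp
  | add x y hx hy => simp only [map_add, hx, hy]
  | tmul s φ =>
    refine TensorProduct.AlgebraTensorModule.curry_injective (LinearMap.ext fun t =>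
      LinearMap.ext fun a => ?_)
    simp

/-- For a presentation `0 → A → B → C → 0` with `B` finite projective, the base change of
`Ext^1_R(C, R) = A^* / B^*` vanishes if and only if `Ext^1_S(S ⊗ C, S) = 0`. -/
lemma IsSES.subsingleton_baseChange_iff (h : IsSES f g) [Module.Projective R B]
    [Module.Finite R B] :
    Subsingleton (S ⊗[R] (Module.Dual R A ⧸ LinearMap.range f.dualMap)) ↔
      ExtVanish S (S ⊗[R] C) S 1 := by
  have : Module.Finite R A := Module.Finite.of_injective f h.inj
  rw [(h.baseChange S).extVanish_one_iff]
  have hex : Function.Exact (f.dualMap.baseChange S) ((LinearMap.range f.dualMap).mkQ.baseChange S) :=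
    lTensor_exact S (LinearMap.exact_map_mkQ_range f.dualMap) (Submodule.mkQ_surjective _)
  have hsurj : Function.Surjective ((LinearMap.range f.dualMap).mkQ.baseChange S) :=
    LinearMap.lTensor_surjective S (Submodule.mkQ_surjective _)
  refine ⟨fun H φ => ?_, fun H => ⟨fun x y => ?_⟩⟩
  · obtain ⟨z, rfl⟩ := (dualBaseChange S A).surjective φ
    obtain ⟨w, rfl⟩ := (hex z).mp (Subsingleton.elim _ _)
    exact ⟨dualBaseChange S B w, (dualBaseChange_dualMap S w).symm⟩
  · suffices ∀ x : S ⊗[R] (Module.Dual R A ⧸ LinearMap.range f.dualMap), x = 0 by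
      rw [this x, this y]
    intro x
    obtain ⟨z, rfl⟩ := hsurj x
    obtain ⟨ψ, hψ⟩ := H (dualBaseChange S A z)
    obtain ⟨w, rfl⟩ := (dualBaseChange S B).surjective ψ
    refine (hex z).mpr ⟨w, (dualBaseChange S A).injective ?_⟩
    rw [dualBaseChange_dualMap]
    exact hψ

omit [IsNoetherianRing R] in
lemma IsSES.subsingleton_ext_iff (h : IsSES f g) [Module.Projective R B] :
    Subsingleton (Module.Dual R A ⧸ LinearMap.range f.dualMap) ↔ ExtVanish R C R 1 := by
  rw [h.extVanish_one_iff, Submodule.Quotient.subsingleton_iff, LinearMap.range_eq_top]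
  rfl

lemma ExtVanish.baseChange [Module.Finite R X] {i : ℕ} (h : ExtVanish R X R (i + 1)) :
    ExtVanish S (S ⊗[R] X) S (i + 1) := by
  obtain ⟨m, π, hπ⟩ := Module.Finite.exists_fin' R X
  have ses := IsSES.ker π hπ
  induction i generalizing X m with
  | zero =>
    rw [zero_add, ← ses.subsingleton_baseChange_iff S]
    have := ses.subsingleton_ext_iff.mpr h
    infer_instance
  | succ i ih =>
    obtain ⟨m', π', hπ'⟩ := Module.Finite.exists_fin' R (LinearMap.ker π)
    exact (ses.baseChange S).shift.mp (ih (ses.shift.mpr h) m' π' hπ' (.ker π' hπ'))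

omit [Module.Flat R S] in
lemma ExtVanish.of_baseChange [Module.FaithfullyFlat R S] [Module.Finite R X] {i : ℕ}
    (h : ExtVanish S (S ⊗[R] X) S (i + 1)) : ExtVanish R X R (i + 1) := by
  obtain ⟨m, π, hπ⟩ := Module.Finite.exists_fin' R X
  have ses := IsSES.ker π hπ
  induction i generalizing X m with
  | zero =>
    rw [zero_add, ← ses.subsingleton_ext_iff]
    have := (ses.subsingleton_baseChange_iff S).mpr h
    exact Module.FaithfullyFlat.lTensor_reflects_triviality R S _
  | succ i ih =>
    obtain ⟨m', π', hπ'⟩ := Module.Finite.exists_fin' R (LinearMap.ker π)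
    exact ses.shift.mp (ih ((ses.baseChange S).shift.mpr h) m' π' hπ' (.ker π' hπ'))

lemma Module.IsReflexive.baseChange [Module.Finite R X] [Module.IsReflexive R X] :
    Module.IsReflexive S (S ⊗[R] X) := by
  have key : (dualBaseChange S X).toLinearMap.dualMap ∘ₗ Module.Dual.eval S (S ⊗[R] X) =
      (dualBaseChange S (Module.Dual R X)).toLinearMap ∘ₗ (Module.Dual.eval R X).baseChange S := by
    refine TensorProduct.AlgebraTensorModule.curry_injective (LinearMap.ext fun s =>
      LinearMap.ext fun x => TensorProduct.AlgebraTensorModule.curry_injective (LinearMap.ext fun t =>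
      LinearMap.ext fun φ => ?_))
    simp [mul_comm]
  have h1 : Function.Bijective ((Module.Dual.eval R X).baseChange S) :=
    ((Module.evalEquiv R X).baseChange R S X _).bijective
  have h2 : Function.Bijective ((dualBaseChange (R := R) S X).toLinearMap.dualMap) :=
    (dualBaseChange S X).dualMap.bijective
  constructor
  have h3 : Function.Bijective ((dualBaseChange S X).toLinearMap.dualMap ∘ₗ
      Module.Dual.eval S (S ⊗[R] X)) := by
    rw [key, LinearMap.coe_comp]
    exact (LinearEquiv.bijective _).comp h1
  rw [LinearMap.coe_comp] at h3
  exact (Function.Bijective.of_comp_iff' h2 _).mp h3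

end FlatBaseChange

/-! ### Totally reflexive modules and finite Gorenstein dimension -/

/-- A totally reflexive module: a finite reflexive module `X` with `Ext^i(X, R) = 0` and
`Ext^i(X^*, R) = 0` for all `i > 0`. -/
structure IsTotallyReflexive (R : Type u) [CommRing R] (X : Type u) [AddCommGroup X]
    [Module R X] : Prop where
  finite : Module.Finite R X
  ext : ∀ i, ExtVanish R X R (i + 1)
  ext_dual : ∀ i, ExtVanish R (Module.Dual R X) R (i + 1)
  reflexive : Module.IsReflexive R X

/-- Modules of finite Gorenstein dimension: those with a finite resolution by totally reflexive
modules, in which all terms but the last one may be taken to be finite free. -/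
inductive FiniteGDim (R : Type u) [CommRing R] :
    ∀ (X : Type u) [AddCommGroup X] [Module R X], Prop
  | of_isTotallyReflexive {X : Type u} [AddCommGroup X] [Module R X]
      (h : IsTotallyReflexive R X) : FiniteGDim R X
  | of_isSES {K X : Type u} [AddCommGroup K] [Module R K] [AddCommGroup X] [Module R X] {m : ℕ}
      {f : K →ₗ[R] (Fin m → R)} {g : (Fin m → R) →ₗ[R] X} (h : IsSES f g)
      (hK : FiniteGDim R K) : FiniteGDim R X

section

variable {R : Type u} [CommRing R] [IsNoetherianRing R] (S : Type u) [CommRing S] [Algebra R S]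
  [Module.Flat R S] {X : Type u} [AddCommGroup X] [Module R X]

lemma ExtVanish.dual_baseChange [Module.Finite R X] {i : ℕ}
    (h : ExtVanish R (Module.Dual R X) R (i + 1)) :
    ExtVanish S (Module.Dual S (S ⊗[R] X)) S (i + 1) :=
  .congr_left (dualBaseChange S X) (h.baseChange S)

lemma IsTotallyReflexive.baseChange (h : IsTotallyReflexive R X) :
    IsTotallyReflexive S (S ⊗[R] X) := by
  have := h.finite
  have := h.reflexive
  exact ⟨inferInstance, fun i => (h.ext i).baseChange S, fun i => (h.ext_dual i).dual_baseChange S,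
    Module.IsReflexive.baseChange S⟩

lemma FiniteGDim.baseChange (h : FiniteGDim R X) : FiniteGDim S (S ⊗[R] X) := by
  induction h with
  | of_isTotallyReflexive h => exact .of_isTotallyReflexive (h.baseChange S)
  | of_isSES h _ ih =>
    exact .of_isSES ((h.baseChange S).congr_mid (TensorProduct.piScalarRight R S S _)) ih

end

/-! ### Biduality along a free presentation -/

section Biduality

variable {R : Type u} [CommRing R] {K X : Type u} [AddCommGroup K] [Module R K]
  [AddCommGroup X] [Module R X] {m : ℕ} {f : K →ₗ[R] (Fin m → R)} {g : (Fin m → R) →ₗ[R] X}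

/-- A functional on `X^*` extends along `X^* → F^*` as soon as `Ext^1(K^*, R) = 0`, and `F` is
reflexive. -/
lemma IsSES.eval_surjective (h : IsSES f g) (hX : ExtVanish R X R 1)
    (hK : ExtVanish R (Module.Dual R K) R 1) : Function.Surjective (Module.Dual.eval R X) := by
  intro ξ
  obtain ⟨ω, rfl⟩ := (h.dual hX).exists_extension hK ξ
  obtain ⟨u, rfl⟩ := (Module.bijective_dual_eval R (Fin m → R)).2 ω
  exact ⟨g u, rfl⟩

/-- If `u ∈ F` is killed by all functionals that vanish on `K`, it is a functional on `K^*`, hence an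
element of `K` as soon as biduality is surjective for `K`. -/
lemma IsSES.eval_injective (h : IsSES f g) (hX : ExtVanish R X R 1)
    (hK : Function.Surjective (Module.Dual.eval R K)) :
    Function.Injective (Module.Dual.eval R X) := by
  rw [injective_iff_map_eq_zero]
  intro x hx
  obtain ⟨u, rfl⟩ := h.surj x
  have hex := LinearMap.exact_lcomp_of_exact_of_surjective R (h.dual hX).exact (h.dual hX).surj
  obtain ⟨ω, hω⟩ := (hex (Module.Dual.eval R _ u)).mp (by
    ext φ; exact LinearMap.congr_fun hx φ)
  obtain ⟨κ, rfl⟩ := hK ω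
  have : f κ = u := (Module.bijective_dual_eval R (Fin m → R)).1 (by
    rw [← hω]; rfl)
  rw [← this, h.exact.apply_apply_eq_zero]

lemma IsTotallyReflexive.of_isSES [IsNoetherianRing R] (h : IsSES f g)
    (hK : IsTotallyReflexive R K) (hX : ∀ i, ExtVanish R X R (i + 1)) :
    IsTotallyReflexive R X := by
  refine ⟨Module.Finite.of_surjective _ h.surj, hX, fun i => ?_, ⟨?_⟩⟩
  · exact (h.dual (hX 0)).contravariant_left (.of_projective _) (hK.ext_dual _)
  · have := hK.reflexive
    exact ⟨h.eval_injective (hX 0) (Module.bijective_dual_eval R K).2,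
      h.eval_surjective (hX 0) (hK.ext_dual 0)⟩

lemma FiniteGDim.isTotallyReflexive [IsNoetherianRing R] (h : FiniteGDim R X)
    (hX : ∀ i, ExtVanish R X R (i + 1)) : IsTotallyReflexive R X := by
  induction h with
  | of_isTotallyReflexive h => exact h
  | of_isSES h _ ih => exact .of_isSES h (ih fun i => h.shift.mpr (hX _)) hX

end Biduality

/-! ### The Auslander–Bridger bound -/

section AuslanderBridger

variable {R : Type u} [CommRing R] {k : Type u} [AddCommGroup k] [Module R k]

/-- If `Ext^{t-1}(k, C) = 0`, then `Ext^t(k, A) → Ext^t(k, B)` is injective; the condition is void for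
`t = 0`. -/
lemma IsSES.ext_eq_zero_of_comp {A B C : Type u} [AddCommGroup A] [Module R A] [AddCommGroup B]
    [Module R B] [AddCommGroup C] [Module R C] {f : A →ₗ[R] B} {g : B →ₗ[R] C} (h : IsSES f g)
    {t : ℕ} (hC : ∀ j, j + 1 = t → ExtVanish R k C j)
    (e : Abelian.Ext (ModuleCat.of R k) (ModuleCat.of R A) t)
    (he : e.comp (Abelian.Ext.mk₀ (ModuleCat.ofHom f)) (add_zero t) = 0) : e = 0 := by
  rcases t with _ | t
  · have : Mono (ModuleCat.ofHom f) := (ModuleCat.mono_iff_injective _).mpr h.inj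
    exact Abelian.Ext.postcomp_mk₀_injective_of_mono _ (ModuleCat.ofHom f)
      (he.trans (map_zero _).symm)
  · obtain ⟨a, rfl⟩ := Abelian.Ext.covariant_sequence_exact₁ _ h.shortExact e he rfl
    rw [ExtVanish.iff_forall.mp (hC t rfl) a, Abelian.Ext.zero_comp]

lemma ExtVanish.dual_pi {m i : ℕ} (h : ExtVanish R k R i) :
    ExtVanish R k (Module.Dual R (Fin m → R)) i :=
  h.pi.congr_right (Module.piEquiv (Fin m) R R)

variable [IsNoetherianRing R] {Y : Type u} [AddCommGroup Y] [Module R Y] [Module.Finite R Y]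

/-- The dual of a module with `Ext^{>0}(Y, R) = 0` is an arbitrarily high syzygy, so its depth is
at least that of the ring. -/
lemma ExtVanish.dual {t : ℕ} (ht : ∀ i < t, ExtVanish R k R i)
    (hY : ∀ i, ExtVanish R Y R (i + 1)) {i : ℕ} (hi : i < t) :
    ExtVanish R k (Module.Dual R Y) i := by
  obtain ⟨m, π, hπ⟩ := Module.Finite.exists_fin' R Y
  have h := IsSES.ker π hπ
  induction i generalizing Y m with
  | zero => exact (h.dual (hY 0)).covariant_left_zero (ht 0 hi).dual_pi
  | succ i ih =>
    obtain ⟨m', π', hπ'⟩ := Module.Finite.exists_fin' R (LinearMap.ker π)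
    exact (h.dual (hY 0)).covariant_left
      (ih (fun i => h.shift.mpr (hY _)) (by omega) m' π' hπ' (.ker π' hπ')) (ht _ hi).dual_pi

/-- An element of `Ext^t(k, Y^*)` in the lowest relevant degree is determined by its images under
the evaluation maps `Y^* → R`. -/
lemma ext_dual_eq_zero {t : ℕ} (ht : ∀ i < t, ExtVanish R k R i)
    (hY : ∀ i, ExtVanish R Y R (i + 1))
    (e : Abelian.Ext (ModuleCat.of R k) (ModuleCat.of R (Module.Dual R Y)) t)
    (he : ∀ y, e.comp (Abelian.Ext.mk₀ (ModuleCat.ofHom (Module.Dual.eval R Y y))) (add_zero t) = 0) :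
    e = 0 := by
  obtain ⟨m, π, hπ⟩ := Module.Finite.exists_fin' R Y
  have h := IsSES.ker π hπ
  refine (h.dual (hY 0)).ext_eq_zero_of_comp
    (fun j hj => .dual ht (fun i => h.shift.mpr (hY _)) (by omega)) e ?_
  let E := Module.piEquiv (Fin m) R R
  have h0 : (e.comp (Abelian.Ext.mk₀ (ModuleCat.ofHom π.dualMap)) (add_zero t)).comp
      (Abelian.Ext.mk₀ E.symm.toModuleIso.hom) (add_zero t) = 0 := by
    refine eq_zero_of_forall_comp_proj _ fun j => ?_
    rw [Abelian.Ext.comp_assoc_of_third_deg_zero, Abelian.Ext.comp_assoc_of_third_deg_zero,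
      Abelian.Ext.mk₀_comp_mk₀, Abelian.Ext.mk₀_comp_mk₀, ← he (π (Pi.single j 1))]
    congr 2
    ext φ
    simp [E, Module.piEquiv, Module.Basis.constr]
  have h1 := congrArg (fun z => z.comp (Abelian.Ext.mk₀ E.symm.toModuleIso.inv) (add_zero t)) h0
  simp only [Abelian.Ext.zero_comp] at h1
  rwa [Abelian.Ext.comp_assoc_of_third_deg_zero, Abelian.Ext.mk₀_comp_mk₀, Iso.hom_inv_id,
    Abelian.Ext.comp_mk₀_id] at h1

/-- Let `t` be minimal with `Ext^t(k, R) ≠ 0`, let `0 → G → R^m → X → 0` be exact with `G` totally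
reflexive and `Ext^{t-1}(k, X) = 0`. Since `Ext^t(k, G) = Hom(G^*, Ext^t(k, R))`, the
injectivity of `Ext^t(k, G) → Ext^t(k, R^m)` says that there is no nonzero map from
`Ext^1(X, R) = coker((R^m)^* → G^*)` to `Ext^t(k, R)`. -/
theorem IsTotallyReflexive.hom_ext_eq_zero {G X : Type u} [AddCommGroup G] [Module R G]
    [AddCommGroup X] [Module R X] (hG : IsTotallyReflexive R G) {m : ℕ}
    {f : G →ₗ[R] (Fin m → R)} {g : (Fin m → R) →ₗ[R] X} (h : IsSES f g) {t : ℕ}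
    (ht : ∀ i < t, ExtVanish R k R i) (hX : ∀ j, j + 1 = t → ExtVanish R k X j)
    (ψ : Module.Dual R G →ₗ[R] Abelian.Ext (ModuleCat.of R k) (ModuleCat.of R R) t)
    (hψ : ψ ∘ₗ f.dualMap = 0) : ψ = 0 := by
  have := hG.finite
  have := hG.reflexive
  obtain ⟨r, π, hπ⟩ := Module.Finite.exists_fin' R (Module.Dual R G)
  have ses := IsSES.ker π hπ
  have sesd := ses.dual (hG.ext_dual 0)
  let γ : G →ₗ[R] Module.Dual R (Fin r → R) := π.dualMap ∘ₗ Module.Dual.eval R G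
  have hev := Module.bijective_dual_eval R G
  have sesγ : IsSES γ (LinearMap.ker π).subtype.dualMap :=
    ⟨sesd.inj.comp hev.1, fun z => (sesd.exact z).trans
      ⟨fun ⟨y, hy⟩ => by obtain ⟨x, rfl⟩ := hev.2 y; exact ⟨x, hy⟩, fun ⟨x, hx⟩ => ⟨_, hx⟩⟩,
      sesd.surj⟩
  -- in terms of a presentation of `G^*`, the map `ψ` is a family of `r` classes in `Ext^t(k, R)`,
  -- that is, a class in `Ext^t(k, R^r)`, which is shown to come from `Ext^t(k, G)`
  let c : Fin r → (R →ₗ[R] Module.Dual R (Fin r → R)) := fun i =>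
    LinearMap.toSpanSingleton R _ (LinearMap.proj i)
  let e' := ∑ i, (ψ (π (Pi.single i 1))).comp (Abelian.Ext.mk₀ (ModuleCat.ofHom (c i))) (add_zero t)
  have he'_eval : ∀ v : Fin r → R, e'.comp (Abelian.Ext.mk₀ (ModuleCat.ofHom
      (Module.Dual.eval R (Fin r → R) v))) (add_zero t) = ψ (π v) := by
    intro v
    have hv : v = ∑ i, v i • (Pi.single i 1 : Fin r → R) := by
      ext j; simp [Finset.sum_apply, Pi.single_apply]
    conv_rhs => rw [hv, map_sum, map_sum]
    rw [Abelian.Ext.sum_comp]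
    refine Finset.sum_congr rfl fun i _ => ?_
    have : ModuleCat.ofHom (c i) ≫ ModuleCat.ofHom (Module.Dual.eval R (Fin r → R) v) =
        v i • 𝟙 (ModuleCat.of R R) := by
      ext
      simp [c]
    rw [Abelian.Ext.comp_assoc_of_third_deg_zero, Abelian.Ext.mk₀_comp_mk₀, this,
      Abelian.Ext.mk₀_smul, Abelian.Ext.comp_smul, Abelian.Ext.comp_mk₀_id, map_smul, map_smul]
  obtain ⟨e, he⟩ : ∃ e : Abelian.Ext (ModuleCat.of R k) (ModuleCat.of R G) t,
      e.comp (Abelian.Ext.mk₀ (ModuleCat.ofHom γ)) (add_zero t) = e' := by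
    refine Abelian.Ext.covariant_sequence_exact₂ _ sesγ.shortExact e' ?_
    refine ext_dual_eq_zero ht (fun i => ses.shift.mpr (hG.ext_dual _)) _ fun w => ?_
    have h2 := he'_eval w
    rw [LinearMap.mem_ker.mp w.2, map_zero] at h2
    rw [Abelian.Ext.comp_assoc_of_third_deg_zero, Abelian.Ext.mk₀_comp_mk₀]
    exact h2
  have he_comp : ∀ φ : Module.Dual R G,
      e.comp (Abelian.Ext.mk₀ (ModuleCat.ofHom φ)) (add_zero t) = ψ φ := by
    intro φ
    obtain ⟨v, rfl⟩ := hπ φ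
    rw [← he'_eval v, ← he, Abelian.Ext.comp_assoc_of_third_deg_zero, Abelian.Ext.mk₀_comp_mk₀]
    rfl
  -- `ψ` vanishes on the functionals that extend to `R^m`, so `e` dies in `Ext^t(k, R^m)`
  have he0 : e = 0 := by
    refine h.ext_eq_zero_of_comp hX e (eq_zero_of_forall_comp_proj _ fun j => ?_)
    rw [Abelian.Ext.comp_assoc_of_third_deg_zero, Abelian.Ext.mk₀_comp_mk₀]
    exact (he_comp (f.dualMap (LinearMap.proj j))).trans (LinearMap.congr_fun hψ _)
  ext φ : 1
  rw [← he_comp φ, he0, Abelian.Ext.zero_comp]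
  rfl

end AuslanderBridger

section Local

variable {R : Type u} [CommRing R] [IsLocalRing R]

/-- A nonzero finite module over a local ring maps nontrivially to every nonzero module killed by
the maximal ideal. -/
lemma IsLocalRing.subsingleton_of_forall_linearMap_eq_zero {E V : Type*} [AddCommGroup E]
    [Module R E] [Module.Finite R E] [AddCommGroup V] [Module R V] [Nontrivial V]
    (hV : ∀ x ∈ IsLocalRing.maximalIdeal R, ∀ v : V, x • v = 0)
    (h : ∀ φ : E →ₗ[R] V, φ = 0) : Subsingleton E := by
  by_contra hE
  rw [not_subsingleton_iff_nontrivial] at hE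
  obtain ⟨N, hN⟩ := IsCoatomic.exists_coatom (Submodule R E)
  have : IsSimpleModule R (E ⧸ N) := isSimpleModule_iff_isCoatom.mpr hN
  obtain ⟨I, hI, ⟨e⟩⟩ := isSimpleModule_iff_quot_maximal.mp this
  obtain rfl := IsLocalRing.eq_maximalIdeal hI
  obtain ⟨v, hv⟩ := exists_ne (0 : V)
  let q : (R ⧸ IsLocalRing.maximalIdeal R) →ₗ[R] V :=
    Submodule.liftQ _ (LinearMap.toSpanSingleton R V v) fun x hx => hV x hx v
  obtain ⟨y, hy⟩ := N.mkQ_surjective (e.symm (Ideal.Quotient.mk _ 1))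
  have h1 := LinearMap.congr_fun (h (q ∘ₗ e.toLinearMap ∘ₗ N.mkQ)) y
  rw [LinearMap.comp_apply, LinearMap.comp_apply, hy, LinearEquiv.coe_coe, e.apply_symm_apply] at h1
  exact hv ((one_smul R v).symm.trans h1)

variable [IsNoetherianRing R] {X : Type u} [AddCommGroup X] [Module R X]

/-- The Auslander–Bridger inequality. If `t` is the depth of `R` and the depth of a module `X`
of finite Gorenstein dimension is at least `t - r`, then `Ext^i(X, R) = 0` for all `i > r`. -/
theorem FiniteGDim.extVanish (hX : FiniteGDim R X) {t : ℕ}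
    (ht : ∀ i < t, ExtVanish R (IsLocalRing.ResidueField R) R i)
    (ht' : ¬ ExtVanish R (IsLocalRing.ResidueField R) R t) {r : ℕ}
    (hr : ∀ i, i + r < t → ExtVanish R (IsLocalRing.ResidueField R) X i) {i : ℕ} (hi : r ≤ i) :
    ExtVanish R X R (i + 1) := by
  induction hX generalizing r i with
  | of_isTotallyReflexive h => exact h.ext i
  | @of_isSES K X _ _ _ _ m f g h hK ih =>
    have hdepth : ∀ j, j < t → (∀ l, l + 1 = j → ExtVanish R (IsLocalRing.ResidueField R) X l) →
        ExtVanish R (IsLocalRing.ResidueField R) K j := by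
      intro j hj hl
      rcases j with _ | j
      · exact h.covariant_left_zero (ht 0 hj).pi
      · exact h.covariant_left (hl j rfl) (ht _ hj).pi
    rcases r with _ | r
    · have hK0 : ∀ j, ExtVanish R K R (j + 1) := fun j =>
        ih (r := 0) (fun i hi => hdepth i hi fun l hl => hr l (by omega)) (Nat.zero_le j)
      have hKtr := hK.isTotallyReflexive hK0
      rcases i with _ | i
      · have := hKtr.finite
        rw [zero_add, ← h.subsingleton_ext_iff]
        have : Nontrivial (Abelian.Ext (ModuleCat.of R (IsLocalRing.ResidueField R))
            (ModuleCat.of R R) t) := not_subsingleton_iff_nontrivial.mp ht'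
        refine IsLocalRing.subsingleton_of_forall_linearMap_eq_zero (R := R)
          (V := Abelian.Ext (ModuleCat.of R (IsLocalRing.ResidueField R)) (ModuleCat.of R R) t)
          (fun x hx v => ?_) fun φ => ?_
        · have hann : x ∈ Module.annihilator R (ModuleCat.of R (IsLocalRing.ResidueField R)) := by
            refine Module.mem_annihilator.mpr fun y => ?_
            rw [← algebraMap_smul (IsLocalRing.ResidueField R) x y,
              IsLocalRing.ResidueField.algebraMap_eq, (IsLocalRing.residue_eq_zero_iff x).mpr hx,
              zero_smul]
          have := DFunLike.congr_fun (congrArg AddCommGrpCat.Hom.hom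
            (Abelian.Ext.postcomp_smul_id_eq_zero_of_mem_annihilator
              (M := ModuleCat.of R R) hann t)) v
          simpa [Abelian.Ext.mk₀_smul] using this
        · -- `Ext^1(X, R)` has no nonzero map to the `k`-vector space `Ext^t(k, R)`
          have h1 := hKtr.hom_ext_eq_zero h ht (fun j hj => hr j (by omega))
            (φ ∘ₗ (LinearMap.range f.dualMap).mkQ) (by
              refine LinearMap.ext fun y => ?_
              have : (LinearMap.range f.dualMap).mkQ (f.dualMap y) = 0 :=
                (Submodule.Quotient.mk_eq_zero _).mpr ⟨y, rfl⟩
              rw [LinearMap.comp_apply, LinearMap.comp_apply, this, map_zero]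
              rfl)
          refine LinearMap.ext fun y => ?_
          obtain ⟨z, rfl⟩ := Submodule.mkQ_surjective _ y
          exact LinearMap.congr_fun h1 z
      · exact h.shift.mp (hK0 i)
    · obtain ⟨i, rfl⟩ : ∃ i', i = i' + 1 := ⟨i - 1, by omega⟩
      exact h.shift.mp (ih (r := r)
        (fun j hj => hdepth j (by omega) fun l hl => hr l (by omega)) (by omega))

end Local

/-! ### Ischebeck's theorem -/

section Ischebeck

variable {R : Type u} [CommRing R]

lemma Module.lt_of_mem_support_quotient_smul {p : PrimeSpectrum R} {x : R} (hx : x ∉ p.asIdeal)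
    {q : PrimeSpectrum R}
    (hq : q ∈ Module.support R
      ((R ⧸ p.asIdeal) ⧸ LinearMap.range (LinearMap.lsmul R (R ⧸ p.asIdeal) x))) : p < q := by
  have h1 := Module.annihilator_le_of_mem_support
    (Module.support_subset_of_surjective _ (Submodule.mkQ_surjective _) hq)
  rw [Ideal.annihilator_quotient] at h1
  refine lt_of_le_of_ne h1 ?_
  rintro rfl
  refine hx (Module.annihilator_le_of_mem_support hq (Module.mem_annihilator.mpr fun y => ?_))
  obtain ⟨y, rfl⟩ := Submodule.mkQ_surjective _ y
  rw [← map_smul]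
  exact (Submodule.Quotient.mk_eq_zero _).mpr ⟨y, rfl⟩

variable [IsNoetherianRing R]

lemma ExtVanish.of_smul_surjective [IsLocalRing R] {A L : Type u} [AddCommGroup A] [Module R A]
    [Module.Finite R A] [AddCommGroup L] [Module R L] [Module.Finite R L] {x : R}
    (hx : x ∈ IsLocalRing.maximalIdeal R) {i : ℕ}
    (h : ∀ e : Abelian.Ext (ModuleCat.of R A) (ModuleCat.of R L) i, ∃ e', x • e' = e) :
    ExtVanish R A L i := by
  have hfin : Module.Finite R (Abelian.Ext (ModuleCat.of R A) (ModuleCat.of R L) i) :=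
    inferInstance
  have h1 : (⊤ : Submodule R (Abelian.Ext (ModuleCat.of R A) (ModuleCat.of R L) i)) = ⊥ := by
    refine Submodule.eq_bot_of_le_smul_of_le_jacobson_bot (IsLocalRing.maximalIdeal R) _
      hfin.fg_top (fun e _ => ?_) (IsLocalRing.maximalIdeal_le_jacobson _)
    obtain ⟨e', rfl⟩ := h e
    exact Submodule.smul_mem_smul hx trivial
  exact ⟨fun a b => by
    have ha : a ∈ (⊤ : Submodule R _) := trivial
    have hb : b ∈ (⊤ : Submodule R _) := trivial
    rw [h1, Submodule.mem_bot] at ha hb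
    rw [ha, hb]⟩

/-- Ischebeck's theorem: `Ext^i(A, L) = 0` for `i < depth L - dim A`. The dimension of `A` is
bounded through the coheights of the primes in its support. -/
theorem ExtVanish.of_coheight_le [IsLocalRing R] {L : Type u} [AddCommGroup L] [Module R L]
    [Module.Finite R L] {δ : ℕ} (hL : ∀ i < δ, ExtVanish R (IsLocalRing.ResidueField R) L i)
    {e : ℕ} {A : Type u} [AddCommGroup A] [Module R A] [Module.Finite R A]
    (hA : ∀ p ∈ Module.support R A, Order.coheight p ≤ e) {i : ℕ} (hi : i + e < δ) :
    ExtVanish R A L i := by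
  induction e using Nat.strong_induction_on generalizing A i with
  | _ e ih =>
  refine IsNoetherianRing.induction_on_isQuotientEquivQuotientPrime R ‹Module.Finite R A›
    (motive := fun N _ _ _ => (∀ p ∈ Module.support R N, Order.coheight p ≤ e) →
      ExtVanish R N L i) ?_ ?_ ?_ hA
  · intro N _ _ _ _ _
    exact .of_subsingleton_left i
  · intro N _ _ _ p E hN
    refine .congr_left E.symm ?_
    have hpN : p ∈ Module.support R N := by
      rw [E.support_eq, Module.mem_support_iff_of_finite, Ideal.annihilator_quotient]
    by_cases hp : p.asIdeal = IsLocalRing.maximalIdeal R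
    · rw [hp]
      exact hL i (by omega)
    · obtain ⟨x, hx, hxp⟩ := SetLike.exists_of_lt
        (lt_of_le_of_ne (IsLocalRing.le_maximalIdeal p.2.ne_top) hp)
      let μ := LinearMap.lsmul R (R ⧸ p.asIdeal) x
      have hμ : Function.Injective μ := by
        rw [injective_iff_map_eq_zero]
        intro y hy
        obtain ⟨y, rfl⟩ := Ideal.Quotient.mk_surjective y
        have hy' : x * y ∈ p.asIdeal := by
          rw [← Ideal.Quotient.eq_zero_iff_mem]; exact hy
        exact Ideal.Quotient.eq_zero_iff_mem.mpr ((p.2.mem_or_mem hy').resolve_left hxp)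
      have hses := IsSES.mkQ μ hμ
      have hpos : 0 < e := by
        have h1 : p < IsLocalRing.closedPoint R := lt_of_le_of_ne
          (IsLocalRing.le_maximalIdeal p.2.ne_top) fun h => hp (congrArg PrimeSpectrum.asIdeal h)
        have h2 := (Order.coheight_add_one_le h1).trans (hN p hpN)
        have h3 : (1 : ℕ∞) ≤ e := le_add_self.trans h2
        exact_mod_cast h3
      have hC : ExtVanish R ((R ⧸ p.asIdeal) ⧸ LinearMap.range μ) L (i + 1) := by
        refine ih (e - 1) (by omega) (fun q hq => ?_) (by omega)
        have h2 := (Order.coheight_add_one_le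
          (Module.lt_of_mem_support_quotient_smul hxp hq)).trans (hN p hpN)
        obtain ⟨e, rfl⟩ : ∃ e', e = e' + 1 := ⟨e - 1, by omega⟩
        rw [Nat.cast_add, Nat.cast_one, ENat.add_le_add_iff_right ENat.one_ne_top] at h2
        exact h2
      refine .of_smul_surjective hx fun ε => ?_
      obtain ⟨ε', h'⟩ := Abelian.Ext.contravariant_sequence_exact₁ hses.shortExact _ ε
        (add_comm 1 i) (ExtVanish.iff_forall.mp hC _)
      refine ⟨ε', ?_⟩
      rw [← h']
      have : hses.exact.shortComplex.f = x • 𝟙 (ModuleCat.of R (R ⧸ p.asIdeal)) := rfl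
      rw [this, Abelian.Ext.mk₀_smul, Abelian.Ext.smul_comp, Abelian.Ext.mk₀_id_comp]
  · intro N₁ _ _ _ N₂ _ _ _ N₃ _ _ _ f g hf hg hfg h₁ h₃ hN
    exact IsSES.contravariant_mid ⟨hf, hfg, hg⟩
      (h₁ fun p hp => hN p (Module.support_subset_of_injective f hf hp))
      (h₃ fun p hp => hN p (Module.support_subset_of_surjective g hg hp))

/-- The depth of a local ring is at most its dimension. -/
lemma IsLocalRing.exists_not_extVanish [IsLocalRing R] {h : ℕ} (hdim : ringKrullDim R ≤ h) :
    ∃ t ≤ h, (∀ i < t, ExtVanish R (IsLocalRing.ResidueField R) R i) ∧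
      ¬ ExtVanish R (IsLocalRing.ResidueField R) R t := by
  have hex : ∃ t ≤ h, ¬ ExtVanish R (IsLocalRing.ResidueField R) R t := by
    by_contra! H
    have h0 : ExtVanish R R R 0 := ExtVanish.of_coheight_le (δ := h + 1)
      (fun i hi => H i (by omega)) (e := h) (fun p _ => ?_) (by omega)
    · exact one_ne_zero (LinearMap.congr_fun (ExtVanish.zero_iff.mp h0 LinearMap.id) (1 : R))
    · exact_mod_cast (Order.coheight_le_krullDim p).trans hdim
  classical
  have hex' : ∃ t, ¬ ExtVanish R (IsLocalRing.ResidueField R) R t := hex.imp fun _ => And.right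
  refine ⟨Nat.find hex', ?_, fun i hi => not_not.mp (Nat.find_min hex' hi), Nat.find_spec hex'⟩
  obtain ⟨t, hth, ht⟩ := hex
  exact (Nat.find_min' hex' ht).trans hth

end Ischebeck

section Dimension

variable {R : Type u} [CommRing R]

lemma PrimeSpectrum.coheight_le_of_le_height {d r : ℕ} (hd : ringKrullDim R = d)
    {p : PrimeSpectrum R} (hp : (r : ℕ∞) ≤ Order.height p) : Order.coheight p ≤ (d - r : ℕ) := by
  have : Nonempty (PrimeSpectrum R) := ⟨p⟩
  rw [ringKrullDim, Order.krullDim_eq_iSup_height_add_coheight_of_nonempty] at hd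
  have h1 : (⨆ q : PrimeSpectrum R, Order.height q + Order.coheight q) = (d : ℕ∞) := by
    exact_mod_cast hd
  have h2 : (r : ℕ∞) + Order.coheight p ≤ d :=
    (add_le_add_left hp _).trans ((le_iSup (fun q : PrimeSpectrum R =>
      Order.height q + Order.coheight q) p).trans h1.le)
  generalize Order.coheight p = c at h2 ⊢
  induction c with
  | top => simp at h2
  | coe c =>
    norm_cast at h2 ⊢
    omega

lemma Module.coheight_le_supportDim {A : Type*} [AddCommGroup A] [Module R A] {e : ℕ}
    (he : Module.supportDim R A ≤ e) {p : PrimeSpectrum R} (hp : p ∈ Module.support R A) :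
    Order.coheight p ≤ e := by
  refine Order.coheight_le fun s hs => ?_
  have hmem : ∀ i, s i ∈ Module.support R A := fun i =>
    Module.mem_support_mono (hs ▸ s.monotone (Fin.zero_le i)) hp
  let s' : LTSeries (Module.support R A) := ⟨s.length, fun i => ⟨s i, hmem i⟩, s.step⟩
  exact_mod_cast (Order.le_krullDim_iff.mpr ⟨s', rfl⟩).trans he

end Dimension

/-! ### The codimension of the supports of `Ext` modules -/

/-- For every `i > 0` the module `Ext^i_R(X, R)` is supported in height at least `i + r`. This is
expressed by the vanishing of the localized modules `Ext^i_{R_p}(X_p, R_p)` for all primes `p` of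
height less than `i + r`. -/
def ExtSupportHeight (R : Type u) [CommRing R] (X : Type u) [AddCommGroup X] [Module R X]
    (r : ℕ) : Prop :=
  ∀ (p : PrimeSpectrum R) (i : ℕ), Order.height p < (i + 1 + r : ℕ) →
    ExtVanish (Localization.AtPrime p.asIdeal) (Localization.AtPrime p.asIdeal ⊗[R] X)
      (Localization.AtPrime p.asIdeal) (i + 1)

section ExtSupportHeight

variable {R : Type u} [CommRing R] [IsNoetherianRing R] {K F X : Type u} [AddCommGroup K]
  [Module R K] [AddCommGroup F] [Module R F] [Module.Projective R F] [AddCommGroup X] [Module R X]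
  {r : ℕ} {f : K →ₗ[R] F} {g : F →ₗ[R] X}

/-- Over `R_p` the Gorenstein dimension of `X_p`, being finite, is at most the depth of `R_p`, hence
at most the height of `p`. -/
lemma FiniteGDim.extSupportHeight (h : FiniteGDim R X) : ExtSupportHeight R X 0 := by
  intro p i hp
  have : IsNoetherianRing (Localization.AtPrime p.asIdeal) :=
    IsLocalization.isNoetherianRing p.asIdeal.primeCompl _ inferInstance
  have hdim : ringKrullDim (Localization.AtPrime p.asIdeal) ≤ i := by
    rw [IsLocalization.AtPrime.ringKrullDim_eq_height p.asIdeal,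
      PrimeSpectrum.height_eq_orderHeight]
    have hp' : Order.height p ≤ (i : ℕ∞) := by
      rw [add_zero, Nat.cast_add, Nat.cast_one] at hp
      exact Order.le_of_lt_add_one hp
    exact_mod_cast hp'
  obtain ⟨t, hti, ht, ht'⟩ := IsLocalRing.exists_not_extVanish hdim
  exact (h.baseChange (Localization.AtPrime p.asIdeal)).extVanish ht ht' (r := t)
    (fun j hj => absurd hj (by omega)) hti

omit [IsNoetherianRing R] in
lemma ExtSupportHeight.syzygy (hX : ExtSupportHeight R X r) (h : IsSES f g) :
    ExtSupportHeight R K (r + 1) := fun p i hp =>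
  (h.baseChange (Localization.AtPrime p.asIdeal)).shift.mpr
    (hX p (i + 1) (by rwa [show i + 1 + 1 + r = i + 1 + (r + 1) by omega]))

/-- If `Ext^{>0}(X, R)` has large codimension, the module `K^* / F^* = Ext^1(X, R)` for a
presentation `0 → K → F → X → 0` has small dimension, so that Ischebeck's theorem applies to it. -/
lemma ExtSupportHeight.extVanish [Module.Finite R F] (hX : ExtSupportHeight R X r)
    (h : IsSES f g) [IsLocalRing R] {d : ℕ} (hd : ringKrullDim R = d) {L : Type u}
    [AddCommGroup L] [Module R L] [Module.Finite R L] {δ : ℕ}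
    (hL : ∀ i < δ, ExtVanish R (IsLocalRing.ResidueField R) L i) {i : ℕ}
    (hi : i + d < δ + (r + 1)) :
    ExtVanish R (Module.Dual R K ⧸ LinearMap.range f.dualMap) L i := by
  have : Module.Finite R K := Module.Finite.of_injective f h.inj
  have hsupp : ∀ p ∈ Module.support R (Module.Dual R K ⧸ LinearMap.range f.dualMap),
      ((r + 1 : ℕ) : ℕ∞) ≤ Order.height p := by
    intro p hp
    by_contra! hlt
    have h1 := hX p 0 (by rwa [show 0 + 1 + r = r + 1 by omega])
    rw [zero_add, ← h.subsingleton_baseChange_iff (Localization.AtPrime p.asIdeal)] at h1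
    exact Module.notMem_support_iff.mpr
      ((LocalizedModule.equivTensorProduct p.asIdeal.primeCompl _).toEquiv.subsingleton) hp
  by_cases hrd : r + 1 ≤ d
  · exact .of_coheight_le hL
      (fun p hp => PrimeSpectrum.coheight_le_of_le_height hd (hsupp p hp)) (by omega)
  · -- no prime has height greater than `d`
    have : Subsingleton (Module.Dual R K ⧸ LinearMap.range f.dualMap) := by
      rw [← Module.support_eq_empty_iff (R := R), Set.eq_empty_iff_forall_notMem]
      intro p hp
      have h1 : ((r + 1 : ℕ) : ℕ∞) ≤ (d : ℕ∞) := by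
        have h2 := Order.height_le_krullDim p
        rw [show Order.krullDim (PrimeSpectrum R) = d from hd] at h2
        exact (hsupp p hp).trans (by exact_mod_cast h2)
      exact hrd (by exact_mod_cast h1)
    exact .of_subsingleton_left i

end ExtSupportHeight

/-! ### Modules of finite projective dimension after a faithfully flat base change -/

instance Algebra.smulCommClass_of_commRing {R Q S : Type*} [CommRing R] [CommRing Q] [CommRing S]
    [Algebra R S] [Algebra Q S] : SMulCommClass R Q S :=
  ⟨fun r q s => by simp only [Algebra.smul_def]; ring⟩

/-- The `R`-modules `X` for which `S ⊗_R X` has finite projective dimension over `Q`, where `S` is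
an algebra over both `R` and `Q`. -/
def FinDeformDim (R Q S : Type u) [CommRing R] [CommRing Q] [CommRing S] [Algebra R S]
    [Algebra Q S] (X : Type u) [AddCommGroup X] [Module R X] : Prop :=
  FinProjDim Q (S ⊗[R] X)

section FinDeformDim

variable {R Q S : Type u} [CommRing R] [CommRing Q] [CommRing S] [Algebra R S] [Algebra Q S]
  {A B C X : Type u} [AddCommGroup A] [Module R A] [AddCommGroup B] [Module R B]
  [AddCommGroup C] [Module R C] [AddCommGroup X] [Module R X]
  {f : A →ₗ[R] B} {g : B →ₗ[R] C}

namespace FinDeformDim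

lemma congr (e : A ≃ₗ[R] B) (h : FinDeformDim R Q S A) : FinDeformDim R Q S B :=
  FinProjDim.congr ((e.baseChange R S A B).restrictScalars Q) h

lemma pi (hQ : HasFinProjDimDuality Q S) (m : ℕ) : FinDeformDim R Q S (Fin m → R) :=
  (hQ.finProjDim.pi m).congr ((TensorProduct.piScalarRight R S S (Fin m)).symm.restrictScalars Q)

lemma dual_pi (hQ : HasFinProjDimDuality Q S) (m : ℕ) :
    FinDeformDim R Q S (Module.Dual R (Fin m → R)) :=
  (FinDeformDim.pi hQ m).congr (Module.piEquiv (Fin m) R R)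

variable [Module.Flat R S]

lemma mid (h : IsSES f g) (h₁ : FinDeformDim R Q S A) (h₃ : FinDeformDim R Q S C) :
    FinDeformDim R Q S B :=
  FinProjDim.mid ((h.baseChange S).restrictScalars Q) h₁ h₃

lemma right (h : IsSES f g) (h₁ : FinDeformDim R Q S A) (h₂ : FinDeformDim R Q S B) :
    FinDeformDim R Q S C :=
  FinProjDim.right ((h.baseChange S).restrictScalars Q) h₁ h₂

lemma left (h : IsSES f g) (h₂ : FinDeformDim R Q S B) (h₃ : FinDeformDim R Q S C) :
    FinDeformDim R Q S A :=
  FinProjDim.left ((h.baseChange S).restrictScalars Q) h₂ h₃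

end FinDeformDim

variable [IsNoetherianRing R] [Module.FaithfullyFlat R S] [Module.Finite R X]

lemma FinDeformDim.dual (hQ : HasFinProjDimDuality Q S) (h : FinDeformDim R Q S X)
    (hX : ∀ i, ExtVanish R X R (i + 1)) :
    FinDeformDim R Q S (Module.Dual R X) ∧ ∀ i, ExtVanish R (Module.Dual R X) R (i + 1) := by
  obtain ⟨h1, h2⟩ := hQ.dual (S ⊗[R] X) h fun i => (hX i).baseChange S
  exact ⟨h1.congr ((dualBaseChange S X).symm.restrictScalars Q),
    fun i => .of_baseChange S ((h2 i).congr_left (dualBaseChange S X).symm)⟩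

lemma FinDeformDim.eval_surjective (hQ : HasFinProjDimDuality Q S) (h : FinDeformDim R Q S X)
    (hX : ∀ i, ExtVanish R X R (i + 1)) : Function.Surjective (Module.Dual.eval R X) := by
  obtain ⟨m, π, hπ⟩ := Module.Finite.exists_fin' R X
  have ses := IsSES.ker π hπ
  exact ses.eval_surjective (hX 0)
    (((FinDeformDim.left ses (.pi hQ m) h).dual hQ fun i => ses.shift.mpr (hX _)).2 0)

lemma FinDeformDim.isTotallyReflexive (hQ : HasFinProjDimDuality Q S) (h : FinDeformDim R Q S X)
    (hX : ∀ i, ExtVanish R X R (i + 1)) : IsTotallyReflexive R X := by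
  obtain ⟨m, π, hπ⟩ := Module.Finite.exists_fin' R X
  have ses := IsSES.ker π hπ
  exact ⟨inferInstance, hX, (h.dual hQ hX).2, ⟨ses.eval_injective (hX 0)
    ((FinDeformDim.left ses (.pi hQ m) h).eval_surjective hQ fun i => ses.shift.mpr (hX _)),
    h.eval_surjective hQ hX⟩⟩

lemma FinDeformDim.finiteGDim (hQ : HasFinProjDimDuality Q S) (h : FinDeformDim R Q S X) :
    FiniteGDim R X := by
  obtain ⟨t, ht⟩ := hQ.bounded (S ⊗[R] X) h
  have ht' : ∀ i, t ≤ i → ExtVanish R X R (i + 1) := fun i hi => .of_baseChange S (ht i hi)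
  clear ht
  induction t generalizing X with
  | zero => exact .of_isTotallyReflexive (h.isTotallyReflexive hQ fun i => ht' i i.zero_le)
  | succ t ih =>
    obtain ⟨m, π, hπ⟩ := Module.Finite.exists_fin' R X
    have ses := IsSES.ker π hπ
    exact .of_isSES ses (ih (.left ses (.pi hQ m) h) fun i hi => ses.shift.mpr (ht' _ (by omega)))

end FinDeformDim

/-! ### Descent of finite deformation dimension from the dual of a maximal Cohen-Macaulay module -/

section MaximalCohenMacaulay

variable {R : Type u} [CommRing R]

/-- If `Hom(E, R) = 0`, then `Hom(E, X^*) = 0` for every module `X`. -/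
lemma ExtVanish.hom_dual {E X : Type u} [AddCommGroup E] [Module R E] [AddCommGroup X]
    [Module R X] (hE : ExtVanish R E R 0) : ExtVanish R E (Module.Dual R X) 0 := by
  rw [ExtVanish.zero_iff] at hE ⊢
  intro φ
  ext e x
  exact LinearMap.congr_fun (hE (Module.Dual.eval R X x ∘ₗ φ)) e

lemma LinearMap.exists_comp_eq_of_ker_le {B C Y : Type*} [AddCommGroup B] [Module R B]
    [AddCommGroup C] [Module R C] [AddCommGroup Y] [Module R Y] {p : B →ₗ[R] C}
    (hp : Function.Surjective p) {φ : B →ₗ[R] Y} (h : LinearMap.ker p ≤ LinearMap.ker φ) :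
    ∃ θ : C →ₗ[R] Y, θ ∘ₗ p = φ := by
  refine ⟨(LinearMap.ker p).liftQ φ h ∘ₗ (p.quotKerEquivOfSurjective hp).symm.toLinearMap,
    LinearMap.ext fun b => ?_⟩
  have : (p.quotKerEquivOfSurjective hp).symm (p b) = Submodule.Quotient.mk b := by
    rw [LinearEquiv.symm_apply_eq]; rfl
  simp only [LinearMap.comp_apply, LinearEquiv.coe_coe, this, Submodule.liftQ_apply]

/-- The dual of an exact sequence `A → B → C → 0`, cut off at the image of the last map. -/
lemma Function.Exact.isSES_dual {A B C : Type u} [AddCommGroup A] [Module R A] [AddCommGroup B]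
    [Module R B] [AddCommGroup C] [Module R C] {f : A →ₗ[R] B} {g : B →ₗ[R] C}
    (h : Function.Exact f g) (hg : Function.Surjective g) :
    IsSES (C := LinearMap.range f.dualMap) g.dualMap f.dualMap.rangeRestrict :=
  ⟨LinearMap.dualMap_injective_of_surjective hg, by
    have := LinearMap.exact_lcomp_of_exact_of_surjective R h hg
    intro y
    rw [← LinearMap.mem_ker, LinearMap.ker_rangeRestrict]
    exact this y, LinearMap.surjective_rangeRestrict _⟩

/-- Let `0 → M^* → F^* → W → 0` be induced by a surjection `F → M` with `F` reflexive. An element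
of `F` whose class is killed by biduality defines a functional on `W`, so the biduality map of `M`
is injective if functionals on `W` come from elements of `F` that vanish in `M`. -/
lemma Module.Dual.eval_injective_of_isSES {F M W : Type u} [AddCommGroup F] [Module R F]
    [Module.IsReflexive R F] [AddCommGroup M] [Module R M] [AddCommGroup W] [Module R W]
    {π : F →ₗ[R] M} (hπ : Function.Surjective π) {p : Module.Dual R F →ₗ[R] W}
    (h : IsSES π.dualMap p)
    (H : ∀ θ : Module.Dual R W, π ((Module.evalEquiv R F).symm (p.dualMap θ)) = 0) :
    Function.Injective (Module.Dual.eval R M) := by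
  rw [injective_iff_map_eq_zero]
  intro x hx
  obtain ⟨u, rfl⟩ := hπ x
  have hker : LinearMap.ker p ≤ LinearMap.ker (Module.Dual.eval R F u) := by
    intro φ hφ
    obtain ⟨ν, rfl⟩ := (h.exact φ).mp hφ
    exact LinearMap.congr_fun hx ν
  obtain ⟨θ, hθ⟩ := LinearMap.exists_comp_eq_of_ker_le h.surj hker
  have hθ' : p.dualMap θ = Module.evalEquiv R F u := hθ
  have h1 := H θ
  rwa [hθ', LinearEquiv.symm_apply_apply] at h1

variable [IsNoetherianRing R] [IsLocalRing R] {d : ℕ} (hd : ringKrullDim R = d)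
  (hR : ∀ i < d, ExtVanish R (IsLocalRing.ResidueField R) R i)

include hd hR in
/-- If `Ext^{>0}(X, R)` has large codimension and `X^*` has large depth, then `E = Ext^1(X, R)`
vanishes: it is the cokernel of an inclusion `F^* / X^* → K^*`, which splits as
`Ext^1(E, F^* / X^*) = 0`, and `Hom(E, K^*) = 0`. -/
theorem ExtSupportHeight.extVanish_one {K X : Type u} [AddCommGroup K] [Module R K]
    [AddCommGroup X] [Module R X] {m : ℕ} {f : K →ₗ[R] (Fin m → R)} {g : (Fin m → R) →ₗ[R] X}
    (h : IsSES f g) {r : ℕ} (hr : 0 < r) (hX : ExtSupportHeight R X r)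
    (hdual : ∀ i, i + r < d + 2 → ExtVanish R (IsLocalRing.ResidueField R) (Module.Dual R X) i) :
    ExtVanish R X R 1 := by
  have : Module.Finite R X := Module.Finite.of_surjective g h.surj
  have hE1 : ExtVanish R (Module.Dual R K ⧸ LinearMap.range f.dualMap) R 1 :=
    hX.extVanish h hd hR (by omega)
  have hE2 : ExtVanish R (Module.Dual R K ⧸ LinearMap.range f.dualMap) (Module.Dual R X) 2 :=
    hX.extVanish h hd (δ := d + 2 - r) (fun i hi => hdual i (by omega)) (by omega)
  refine h.subsingleton_ext_iff.mp ((IsSES.quotient (LinearMap.range f.dualMap)).subsingleton_right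
    ((h.exact.isSES_dual h.surj).covariant_right
      (hE1.pi.congr_right (Module.piEquiv (Fin m) R R)) hE2)
    (hX.extVanish h hd hR (by omega)).hom_dual)

include hd hR in
/-- All `Ext^{>0}(X, R)` vanish under the assumptions of `ExtSupportHeight.extVanish_one`: passing to
a syzygy raises the codimension by one and lowers the bound on the depth of the dual by one. -/
theorem ExtSupportHeight.extVanish_of_depth_dual {X : Type u} [AddCommGroup X] [Module R X]
    [Module.Finite R X] {r : ℕ} (hr : 0 < r) (hX : ExtSupportHeight R X r)
    (hdual : ∀ i, i + r < d + 2 → ExtVanish R (IsLocalRing.ResidueField R) (Module.Dual R X) i)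
    (i : ℕ) : ExtVanish R X R (i + 1) := by
  obtain ⟨m, π, hπ⟩ := Module.Finite.exists_fin' R X
  have h := IsSES.ker π hπ
  have h1 : ExtVanish R X R 1 := hX.extVanish_one hd hR h hr hdual
  induction i generalizing X r m with
  | zero => exact h1
  | succ i ih =>
    refine h.shift.mp ?_
    have hdual' : ∀ i, i + (r + 1) < d + 2 →
        ExtVanish R (IsLocalRing.ResidueField R) (Module.Dual R (LinearMap.ker π)) i :=
      fun i hi => (h.dual h1).covariant_right (hR i (by omega)).dual_pi (hdual _ (by omega))
    obtain ⟨m', π', hπ'⟩ := Module.Finite.exists_fin' R (LinearMap.ker π)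
    exact ih r.succ_pos (hX.syzygy h) hdual' m' π' hπ' (.ker π' hπ')
      ((hX.syzygy h).extVanish_one hd hR (.ker π' hπ') r.succ_pos hdual')

include hd hR in
/-- Let `M` be a finite module of depth `dim R`, with dual `N`. A presentation `G₁ → G₀ → M → 0`
makes `N` the second syzygy of the cokernel `W` of `G₀^* → G₁^*`. If `Ext^{>0}(W, R)` has the
codimension of a module of finite Gorenstein dimension, the kernel and the cokernel of the biduality
map of `M`, which are `Ext^1(W, R)` and `Ext^2(W, R)`, vanish, and so do the modules
`Ext^{>0}(N, R)`. -/
theorem ExtSupportHeight.bijective_dual_eval {M G : Type u} [AddCommGroup M] [Module R M]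
    [Module.Finite R M] [AddCommGroup G] [Module R G] [Module.Finite R G] [Module.Projective R G]
    (hM : ∀ i < d, ExtVanish R (IsLocalRing.ResidueField R) M i) {m : ℕ}
    {a : G →ₗ[R] (Fin m → R)} {π : (Fin m → R) →ₗ[R] M} (hex : Function.Exact a π)
    (hπ : Function.Surjective π)
    (hW : ExtSupportHeight R (Module.Dual R G ⧸ LinearMap.range a.dualMap) 0) :
    Function.Bijective (Module.Dual.eval R M) ∧ ∀ i, ExtVanish R (Module.Dual R M) R (i + 1) := by
  have ses₁ := IsSES.quotient (LinearMap.range a.dualMap)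
  have ses₂ := hex.isSES_dual hπ
  have hW₁ : ExtSupportHeight R (LinearMap.range a.dualMap) 1 := hW.syzygy ses₁
  have hN : ExtSupportHeight R (Module.Dual R M) 2 := hW₁.syzygy ses₂
  have hinj : Function.Injective (Module.Dual.eval R M) := by
    -- a functional on the image of `G₀^*` is evaluation at an element of `G₀`, whose image in `M`
    -- depends only on its class in `Ext^1(W, R)`
    let ρ : Module.Dual R (LinearMap.range a.dualMap) →ₗ[R] M :=
      π ∘ₗ (Module.evalEquiv R (Fin m → R)).symm.toLinearMap ∘ₗ a.dualMap.rangeRestrict.dualMap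
    have hρ : LinearMap.range (LinearMap.range a.dualMap).subtype.dualMap ≤ LinearMap.ker ρ := by
      rintro _ ⟨ψ, rfl⟩
      obtain ⟨y, rfl⟩ := (Module.bijective_dual_eval R G).2 ψ
      have : a.dualMap.rangeRestrict.dualMap
          ((LinearMap.range a.dualMap).subtype.dualMap (Module.Dual.eval R G y)) =
          Module.evalEquiv R (Fin m → R) (a y) := rfl
      rw [LinearMap.mem_ker]
      simp only [ρ, LinearMap.comp_apply, this, LinearEquiv.coe_coe, LinearEquiv.symm_apply_apply]
      exact hex.apply_apply_eq_zero y
    have h0 := ExtVanish.zero_iff.mp (hW.extVanish ses₁ hd hM (i := 0) (by omega))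
      (Submodule.liftQ _ ρ hρ)
    exact Module.Dual.eval_injective_of_isSES hπ ses₂
      fun θ => LinearMap.congr_fun h0 (Submodule.Quotient.mk θ)
  have hsurj : Function.Surjective (Module.Dual.eval R M) := by
    have hrange : LinearMap.range π.dualMap.dualMap = LinearMap.range (Module.Dual.eval R M) := by
      have h1 : π.dualMap.dualMap ∘ₗ Module.Dual.eval R (Fin m → R) =
          Module.Dual.eval R M ∘ₗ π := rfl
      rw [← LinearMap.range_comp_of_range_eq_top (Module.Dual.eval R M)
        (LinearMap.range_eq_top.mpr hπ), ← h1, LinearMap.range_comp_of_range_eq_top _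
        (LinearMap.range_eq_top.mpr (Module.bijective_dual_eval R (Fin m → R)).2)]
    -- the cokernel `E = Ext^2(W, R)` of biduality satisfies `Ext^1(E, M) = 0` and `Hom(E, M^**) = 0`
    have hE1 := hW₁.extVanish ses₂ hd hM (i := 1) (by omega)
    have hE0 := (hW₁.extVanish ses₂ hd hR (i := 0) (by omega)).hom_dual (X := Module.Dual R M)
    rw [hrange] at hE0 hE1
    have := (IsSES.mkQ _ hinj).subsingleton_right hE1 hE0
    rwa [Submodule.Quotient.subsingleton_iff, LinearMap.range_eq_top] at this
  refine ⟨⟨hinj, hsurj⟩, hN.extVanish_of_depth_dual hd hR two_pos fun i hi => ?_⟩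
  exact (hM i (by omega)).congr_right (LinearEquiv.ofBijective _ ⟨hinj, hsurj⟩)

include hd hR in
/-- A finite module of depth `dim R` has finite deformation dimension if its dual does. -/
theorem FinDeformDim.of_dual {Q S : Type u} [CommRing Q] [CommRing S] [Algebra R S] [Algebra Q S]
    [Module.FaithfullyFlat R S] (hQ : HasFinProjDimDuality Q S) {M : Type u} [AddCommGroup M]
    [Module R M] [Module.Finite R M]
    (hM : ∀ i < d, ExtVanish R (IsLocalRing.ResidueField R) M i)
    (h : FinDeformDim R Q S (Module.Dual R M)) : FinDeformDim R Q S M := by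
  obtain ⟨m, π, hπ⟩ := Module.Finite.exists_fin' R M
  obtain ⟨n, ρ, hρ⟩ := Module.Finite.exists_fin' R (LinearMap.ker π)
  let a : (Fin n → R) →ₗ[R] (Fin m → R) := (LinearMap.ker π).subtype ∘ₗ ρ
  have hex : Function.Exact a π := by
    intro y
    rw [← LinearMap.mem_ker]
    refine ⟨fun hy => ?_, ?_⟩
    · obtain ⟨z, hz⟩ := hρ ⟨y, hy⟩
      exact ⟨z, congrArg Subtype.val hz⟩
    · rintro ⟨z, rfl⟩
      exact (ρ z).2
  have hW₁ : FinDeformDim R Q S (LinearMap.range a.dualMap) :=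
    .right (hex.isSES_dual hπ) h (.dual_pi hQ m)
  have hW : FinDeformDim R Q S (Module.Dual R (Fin n → R) ⧸ LinearMap.range a.dualMap) :=
    .right (.quotient _) hW₁ (.dual_pi hQ n)
  obtain ⟨hbij, hN⟩ := ExtSupportHeight.bijective_dual_eval hd hR hM hex hπ
    (hW.finiteGDim hQ).extSupportHeight
  exact (h.dual hQ hN).1.congr (LinearEquiv.ofBijective _ hbij).symm

end MaximalCohenMacaulay

/-! ### Cohen-Macaulay modules and their `Ext` duals -/

section CohenMacaulay

variable {R : Type u} [CommRing R] [IsLocalRing R]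

/-- Over a ring of depth at least `d`, a syzygy of a module of depth at least `d - (n + 1)` has depth
at least `d - n`. -/
lemma IsSES.extVanish_residueField {d n : ℕ} {K M : Type u} [AddCommGroup K] [Module R K]
    [AddCommGroup M] [Module R M] {m : ℕ} {f : K →ₗ[R] (Fin m → R)} {g : (Fin m → R) →ₗ[R] M}
    (h : IsSES f g) (hR : ∀ i < d, ExtVanish R (IsLocalRing.ResidueField R) R i)
    (hM : ∀ i, i + (n + 1) < d → ExtVanish R (IsLocalRing.ResidueField R) M i)
    (i : ℕ) (hi : i + n < d) : ExtVanish R (IsLocalRing.ResidueField R) K i := by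
  rcases i with _ | i
  · exact h.covariant_left_zero (hR 0 (by omega)).pi
  · exact h.covariant_left (hM i (by omega)) (hR (i + 1) (by omega)).pi

variable [IsNoetherianRing R] {d : ℕ} (hd : ringKrullDim R = d)
  (hR : ∀ i < d, ExtVanish R (IsLocalRing.ResidueField R) R i)
  {Q S : Type u} [CommRing Q] [CommRing S] [Algebra R S] [Algebra Q S]
  [Module.FaithfullyFlat R S] (hQ : HasFinProjDimDuality Q S)

include hd hR hQ in
/-- A module of depth `dim R` and finite Gorenstein dimension has `Ext^{>0}(M, R) = 0`, so that
duality applies to it; the converse is `FinDeformDim.of_dual`. -/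
lemma FinDeformDim.iff_dual {M : Type u} [AddCommGroup M] [Module R M] [Module.Finite R M]
    (hM : ∀ i < d, ExtVanish R (IsLocalRing.ResidueField R) M i) :
    FinDeformDim R Q S M ↔ FinDeformDim R Q S (Module.Dual R M) := by
  refine ⟨fun h => ?_, fun h => h.of_dual hd hR hQ hM⟩
  obtain ⟨t, htd, ht, ht'⟩ := IsLocalRing.exists_not_extVanish hd.le
  exact (h.dual hQ fun i => (h.finiteGDim hQ).extVanish ht ht' (r := 0)
    (fun j hj => hM j (by omega)) i.zero_le).1

include hd hR hQ in
/-- Induction over syzygies reduces a module `M` of depth `d - (n + 1)` to a maximal Cohen-Macaulay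
module. As the dual of a syzygy does not vanish, the case `i = 0` of the condition `Ext^i(M, R) = 0`
for `i ≤ n` is weakened to a condition on `M^*`. -/
theorem FinDeformDim.iff_ext_succ {n : ℕ} {M : Type u} [AddCommGroup M] [Module R M]
    [Module.Finite R M]
    (hM : ∀ i, i + (n + 1) < d → ExtVanish R (IsLocalRing.ResidueField R) M i)
    (hext : ∀ i < n, ExtVanish R M R (i + 1)) (hdual : FinDeformDim R Q S (Module.Dual R M)) :
    FinDeformDim R Q S M ↔
      FinDeformDim R Q S (Abelian.Ext (ModuleCat.of R M) (ModuleCat.of R R) (n + 1)) := by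
  obtain ⟨m, π, hπ⟩ := Module.Finite.exists_fin' R M
  have h := IsSES.ker π hπ
  have hK := h.extVanish_residueField hR hM
  have hiff : FinDeformDim R Q S M ↔ FinDeformDim R Q S (LinearMap.ker π) :=
    ⟨fun hM => .left h (.pi hQ m) hM, fun hK => .right h hK (.pi hQ m)⟩
  rw [hiff]
  induction n generalizing M m with
  | zero =>
    rw [FinDeformDim.iff_dual hd hR hQ hK]
    -- `0 → M^* → F^* → B → 0` and `0 → B → K^* → Ext^1(M, R) → 0`
    have hB : FinDeformDim R Q S (LinearMap.range (LinearMap.ker π).subtype.dualMap) :=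
      .right (h.exact.isSES_dual h.surj) hdual (.dual_pi hQ m)
    have hker : LinearMap.range (LinearMap.ker π).subtype.dualMap =
        LinearMap.ker (h.connecting R) :=
      Submodule.ext fun φ => (h.connecting_eq_zero_iff φ).symm
    have hses := IsSES.ker (h.connecting R) h.connecting_surjective
    rw [hker] at hB
    exact ⟨fun hK => .right hses hB hK, fun hE => .mid hses hB hE⟩
  | succ n ih =>
    have e := h.shiftEquiv R n
    obtain ⟨m', π', hπ'⟩ := Module.Finite.exists_fin' R (LinearMap.ker π)
    have h' := IsSES.ker π' hπ'
    have hiff' : FinDeformDim R Q S (LinearMap.ker π) ↔ FinDeformDim R Q S (LinearMap.ker π') :=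
      ⟨fun hM => .left h' (.pi hQ m') hM, fun hK => .right h' hK (.pi hQ m')⟩
    have ih' := ih hK (fun i hi => h.shift.mpr (hext (i + 1) (by omega)))
      (.right (h.dual (hext 0 n.succ_pos)) hdual (.dual_pi hQ m)) m' π' hπ' h'
      (h'.extVanish_residueField hR hK) hiff'
    exact hiff'.trans (ih'.trans ⟨fun H => H.congr e, fun H => H.congr e.symm⟩)

include hd hR hQ in
/-- The equivalence between `M` and `Ext^n(M, R)` for a module of depth at least `d - n` with
`Ext^i(M, R) = 0` for `i < n`. -/
theorem FinDeformDim.iff_ext {n : ℕ} {M : Type u} [AddCommGroup M] [Module R M]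
    [Module.Finite R M]
    (hM : ∀ i, i + n < d → ExtVanish R (IsLocalRing.ResidueField R) M i)
    (hext : ∀ i < n, ExtVanish R M R i) :
    FinDeformDim R Q S M ↔
      FinDeformDim R Q S (Abelian.Ext (ModuleCat.of R M) (ModuleCat.of R R) n) := by
  rcases n with _ | n
  · rw [FinDeformDim.iff_dual hd hR hQ hM]
    let e : Abelian.Ext (ModuleCat.of R M) (ModuleCat.of R R) 0 ≃ₗ[R] Module.Dual R M :=
      Abelian.Ext.linearEquiv₀.trans ModuleCat.homLinearEquiv
    exact ⟨fun H => H.congr e.symm, fun H => H.congr e⟩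
  · refine FinDeformDim.iff_ext_succ hd hR hQ hM (fun i hi => hext (i + 1) (by omega)) ?_
    have : Subsingleton (Module.Dual R M) :=
      ⟨fun a b => by
        have h0 := ExtVanish.zero_iff.mp (hext 0 n.succ_pos)
        rw [h0 a, h0 b]⟩
    exact .congr (LinearEquiv.ofSubsingleton (Fin 0 → R) (Module.Dual R M)) (.pi hQ 0)

end CohenMacaulay

/-! ### Complete intersection dimension -/

section CIDim

variable {R : Type u} [CommRing R] [IsLocalRing R]

lemma QuasiDeformation.pd_ne_top_iff (D : QuasiDeformation R) (X : Type u) [AddCommGroup X]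
    [Module D.R' X] [i : Module D.Q X] [IsScalarTower D.Q D.R' X] :
    D.pd X ≠ ⊤ ↔ FinProjDim D.Q X := by
  -- the scalar tower forces the given `Q`-module structure to be the restriction of scalars
  obtain rfl : i = Module.compHom X (algebraMap D.Q D.R') :=
    Module.ext' _ _ fun q x => (algebraMap_smul D.R' q x).symm
  let : Module D.Q X := Module.compHom X (algebraMap D.Q D.R')
  have h1 : D.pd X ≠ ⊤ ↔ projectiveDimension (ModuleCat.of D.Q X) ≠ ⊤ := by
    change WithBot.recBotCoe (C := fun _ => EReal) ⊥ (fun n : ℕ∞ => ((n : ENNReal) : EReal))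
      (projectiveDimension (ModuleCat.of D.Q X)) ≠ ⊤ ↔ _
    generalize projectiveDimension (ModuleCat.of D.Q X) = p
    induction p with
    | bot => simp
    | coe p =>
      change (((p : ENNReal) : EReal)) ≠ ⊤ ↔ _
      rw [not_iff_not, EReal.coe_ennreal_eq_top_iff, ENat.toENNReal_eq_top]
      exact ⟨fun h => by rw [h]; rfl, fun h => WithBot.coe_injective h⟩
  rw [h1, projectiveDimension_ne_top_iff]
  exact ⟨fun ⟨n, hn⟩ => ⟨n + 1, hn⟩, fun ⟨n, hn⟩ => ⟨n, hasProjectiveDimensionLT_of_ge _ n _ n.le_succ⟩⟩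

lemma QuasiDeformation.pd_self_ne_bot (D : QuasiDeformation R) : D.pd D.R' ≠ ⊥ := by
  let X := (ModuleCat.restrictScalars (algebraMap D.Q D.R')).obj (ModuleCat.of D.R' D.R')
  have h1 : ¬ Limits.IsZero X := by
    rw [ModuleCat.isZero_iff_subsingleton, not_subsingleton_iff_nontrivial]
    exact inferInstanceAs (Nontrivial D.R')
  rw [← projectiveDimension_eq_bot_iff] at h1
  change WithBot.recBotCoe (C := fun _ => EReal) ⊥ (fun n : ℕ∞ => ((n : ENNReal) : EReal))
    (projectiveDimension X) ≠ ⊥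
  generalize projectiveDimension X = p at h1 ⊢
  induction p with
  | bot => exact absurd rfl h1
  | coe p => exact EReal.coe_ennreal_ne_bot _

lemma QuasiDeformation.hasFinProjDimDuality (D : QuasiDeformation R) :
    HasFinProjDimDuality D.Q D.R' := by
  obtain ⟨rs, hrs, hk⟩ := D.exists_regular
  exact .of_isWeaklyRegular rs hrs.toIsWeaklyRegular D.R' D.surjective hk

lemma QuasiDeformation.faithfullyFlat (D : QuasiDeformation R) : Module.FaithfullyFlat R D.R' :=
  have := D.flat
  have := D.isLocalHom_left
  .of_flat_of_isLocalHom

/-- No truncation occurs in the difference defining `ciDim`, as `pd_Q R'` is finite. -/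
lemma ciDim_lt_top_iff (X : Type u) [AddCommGroup X] [Module R X] :
    ciDim R X < ⊤ ↔ ∃ D : QuasiDeformation R, FinDeformDim R D.Q D.R' X := by
  rw [ciDim, iInf_lt_top]
  refine exists_congr fun D => ?_
  have h1 : D.pd D.R' ≠ ⊤ := (D.pd_ne_top_iff _).mpr D.hasFinProjDimDuality.finProjDim
  rw [EReal.sub_lt_iff (.inl D.pd_self_ne_bot) (.inl h1), EReal.top_add_of_ne_bot D.pd_self_ne_bot,
    lt_top_iff_ne_top, D.pd_ne_top_iff]
  rfl

lemma ExtVanish.of_lt_moduleDepth {M : Type u} [AddCommGroup M] [Module R M] {i : ℕ}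
    (hi : i < moduleDepth R M) : ExtVanish R (IsLocalRing.ResidueField R) M i := by
  by_contra h
  exact absurd (iInf₂_le i (not_subsingleton_iff_nontrivial.mp h)) (not_le.mpr hi)

end CIDim

theorem mainTheorem12 (R : Type u) [CommRing R] [IsLocalRing R] [IsNoetherianRing R]
    (M : Type u) [AddCommGroup M] [Module R M] [Module.Finite R M]
    (d s : ℕ) (hR : IsCohenMacaulayModule R R) (hd : ringKrullDim R = d)
    (hM : IsCohenMacaulayModule R M) (hs : moduleDepth R M = s) :
    ciDim R M < ⊤ ↔
      ciDim R (Abelian.Ext (ModuleCat.of R M) (ModuleCat.of R R) (d - s)) < ⊤ := by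
  rw [ciDim_lt_top_iff, ciDim_lt_top_iff]
  rw [IsCohenMacaulayModule, Module.supportDim_self_eq_ringKrullDim, hd] at hR
  rw [IsCohenMacaulayModule, hs] at hM
  have hR' : moduleDepth R R = d := by exact_mod_cast hR
  have hdepthR : ∀ i < d, ExtVanish R (IsLocalRing.ResidueField R) R i := fun i hi =>
    .of_lt_moduleDepth (by rw [hR']; exact_mod_cast hi)
  have hdepthM : ∀ i < s, ExtVanish R (IsLocalRing.ResidueField R) M i := fun i hi =>
    .of_lt_moduleDepth (by rw [hs]; exact_mod_cast hi)
  have hext : ∀ i < d - s, ExtVanish R M R i := fun i hi =>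
    .of_coheight_le hdepthR (e := s)
      (fun p hp => Module.coheight_le_supportDim (by rw [← hM]; rfl) hp) (by omega)
  -- the same quasi-deformation serves for both modules
  refine exists_congr fun D => ?_
  have := D.faithfullyFlat
  exact FinDeformDim.iff_ext hd hdepthR D.hasFinProjDimDuality
    (fun i hi => hdepthM i (by omega)) hext
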